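/- Let $\operatorname{tww}(G)$ denote the twin-width of a finite graph $G$: the least integer $w\ge 0$ for which there is a sequence of partitions of $V(G)$, starting with the partition into singletons and ending with at most one part, each obtained from the previous one by merging two parts, such that in every partition of the sequence each part $A$ forms a red pair with at most $w$ other parts $B$, where distinct parts $A,B$ form a red pair if they are neither fully adjacent nor fully non-adjacent in $G$. Let $d\ge 2$ be an integer. Then there is a function $\varepsilon:\mathbb N\to\mathbb R$ with $\varepsilon(n)\to 0$ as $n\to\infty$ such that every $n$-vertex $d$-regular graph $G$ satisfies $$\operatorname{tww}(G)\le n^{\frac{d-2}{2d-2}+\varepsilon(n)}.$$ Moreover, this holds with equality, up to the error in the exponent, for almost all $n$-vertex $d$-regular graphs: there is a function $\varepsilon':\mathbb N\to\mathbb R$ with $\varepsilon'(n)\to 0$ such that the proportion of the $d$-regular graphs $G$ with vertex set $\{1,\dots,n\}$ that satisfy $$n^{\frac{d-2}{2d-2}-\varepsilon'(n)}\le\operatorname{tww}(G)\le n^{\frac{d-2}{2d-2}+\varepsilon'(n)}$$ tends to $1$ as $n\to\infty$ with $dn$ even. -/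

import Mathlib

open Filter Topology

/-- Two distinct parts `A`, `B` are joined by a red edge when they are neither fully adjacent nor
fully non-adjacent in `G`. -/
def RedAdj {V : Type*} (G : SimpleGraph V) (A B : Finset V) : Prop :=
  A ≠ B ∧ ¬ (∀ a ∈ A, ∀ b ∈ B, G.Adj a b) ∧ ¬ (∀ a ∈ A, ∀ b ∈ B, ¬ G.Adj a b)

/-- The number of red edges at the part `A` of the partition `P`. -/
noncomputable def redDegree {V : Type*} [Fintype V] [DecidableEq V] (G : SimpleGraph V)
    (P : Finpartition (Finset.univ : Finset V)) (A : Finset V) : ℕ :=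
  Set.ncard {B : Finset V | B ∈ P.parts ∧ RedAdj G A B}

/-- `Q` is obtained from `P` by merging two distinct parts: one vertex identification. -/
def IsMerge {V : Type*} [Fintype V] [DecidableEq V]
    (P Q : Finpartition (Finset.univ : Finset V)) : Prop :=
  ∃ A ∈ P.parts, ∃ B ∈ P.parts, A ≠ B ∧
    Q.parts = insert (A ∪ B) ((P.parts.erase A).erase B)

/-- `G` can be reduced to (at most) one vertex by successive identifications of two vertices, such
that at every step every vertex is incident with at most `w` red edges. The vertices of the
`i`-th trigraph are the parts of `P i`; here `⊥` is the partition into singletons. -/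
def HasContractionSequence {V : Type*} [Fintype V] [DecidableEq V] (G : SimpleGraph V)
    (w : ℕ) : Prop :=
  ∃ (k : ℕ) (P : ℕ → Finpartition (Finset.univ : Finset V)),
    P 0 = ⊥ ∧ (P k).parts.card ≤ 1 ∧ (∀ i < k, IsMerge (P i) (P (i + 1))) ∧
      ∀ i ≤ k, ∀ A ∈ (P i).parts, redDegree G (P i) A ≤ w

/-- The twin-width of a finite graph. -/
noncomputable def twinWidth {V : Type*} [Fintype V] [DecidableEq V] (G : SimpleGraph V) : ℕ :=
  sInf {w : ℕ | HasContractionSequence G w}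

open scoped Classical in
/-- The `d`-regular graphs with vertex set `Fin n`. -/
def regularGraphs (d n : ℕ) : Set (SimpleGraph (Fin n)) :=
  {G | G.IsRegularOfDegree d}

/-- Almost all `n`-vertex `d`-regular graphs satisfy `p n`: the proportion of them among the
`d`-regular graphs on `Fin n` tends to `1` as `n → ∞` with `d * n` even (for `d * n` odd there
are no such graphs). -/
def AlmostAllRegular (d : ℕ) (p : ∀ n : ℕ, SimpleGraph (Fin n) → Prop) : Prop :=
  Tendsto
    (fun n : ℕ => (Set.ncard {G ∈ regularGraphs d n | p n G} : ℝ) / Set.ncard (regularGraphs d n))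
    (atTop ⊓ 𝓟 {n : ℕ | Even (d * n)}) (𝓝 1)

/-!
# The twin-width of regular graphs

Put `γ = (d - 2) / (2 * d - 2)`.

**Upper bound.** The idea is to label the vertices so that adjacent vertices share as large a part
of their labels as possible. Choose at each vertex `v` a permutation without fixed points of the
edges at `v`. Entering `v` along an edge and leaving along its image decomposes the graph with
doubled edges into closed walks without backtracking, which visit each vertex `d` times. Cut
these walks, in `D` different ways, into segments of at most `2 * D` steps such that each step is
cut at most once (`Equiv.Perm.exists_segments`). The set of vertices visited by a segment and the
set of those visited at least twice form a family of small sets such that every vertex lies in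
`K = D * d` of them, while the ends of an edge have `2 * (D - 2)` of them in common; it is here that
backtracking has to be excluded (`exists_cover_sets`). Give each set a random label of `J` bits,
and each vertex the vector of the `K` labels of its sets. For `2 ^ (J * K) ≈ n ^ (1 - γ)`, no vector
belongs to more than `n ^ (γ + o(1))` vertices (`exists_balanced_labelling`), so that the vertices
with equal vectors can be merged within this red degree. Then the labels are truncated bit by bit.
Since adjacent vectors share a proportion of about `2 / d` of their entries, the red degree is
now at most about `(2 ^ (J * K)) ^ (1 - 2 / d) ≈ n ^ γ`; see `hasContractionSequence_of_cover`.

**Lower bound.** This is a counting argument. In a contraction sequence of width `w`, detach pieces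
of between `s` and `2 * s` vertices from the parts as soon as they are large enough. At this moment
the piece has edges to at most `w` parts, and the remainders of these are contained in single
pieces later on. So the vertices are divided into about `n / s` pieces such that the edges run
between at most `w * n / s` pairs of pieces (`HasContractionSequence.exists_pieces`). For `s` slightly
larger than `w`, the pairs are described by `o(n * log n)` bits, and there are up to factors
`n ^ o(n)` at most `(n / s) ^ n * (w * s) ^ (d * n / 2)` graphs of this kind
(`ncard_graphs_with_pieces_le`). If `w ≤ n ^ (γ - δ)`, this is much less than the number
`n ^ (d * n / 2)` of `d`-regular graphs, again up to such factors, which is bounded from below by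
counting lifts of the complete graph on `d + 1` vertices (`factorial_pow_le_ncard_regularGraphs`).
For `d = 2` only twin-width zero has to be excluded, with pieces of bounded size; here the
number of partitions has to be estimated more carefully, by `card_boundedRetractions_le`.
-/

/-! ### Partitions and contraction sequences -/

section Contraction

variable {V : Type*} [Fintype V] [DecidableEq V]

lemma Finpartition.part_univ_mem (P : Finpartition (Finset.univ : Finset V)) (x : V) :
    P.part x ∈ P.parts :=
  P.part_mem.2 (Finset.mem_univ x)

lemma Finpartition.self_mem_part_univ (P : Finpartition (Finset.univ : Finset V)) (x : V) :
    x ∈ P.part x :=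
  P.mem_part (Finset.mem_univ x)

lemma Finpartition.part_bot_univ (x : V) :
    (⊥ : Finpartition (Finset.univ : Finset V)).part x = {x} := by
  apply Finpartition.part_eq_of_mem
  · rw [Finpartition.mem_bot_iff]
    exact ⟨x, Finset.mem_univ x, rfl⟩
  · simp

lemma exists_isMerge (P : Finpartition (Finset.univ : Finset V)) {A B : Finset V}
    (hA : A ∈ P.parts) (hB : B ∈ P.parts) (hAB : A ≠ B) :
    ∃ Q : Finpartition (Finset.univ : Finset V),
      Q.parts = insert (A ∪ B) ((P.parts.erase A).erase B) := by
  refine ⟨Finpartition.ofExistsUnique (insert (A ∪ B) ((P.parts.erase A).erase B))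
    (fun p _ => Finset.subset_univ p) ?_ ?_, rfl⟩
  · intro x _
    have key : ∀ t ∈ (P.parts.erase A).erase B, x ∈ t → x ∉ A ∪ B := by
      intro t ht hxt hx
      simp only [Finset.mem_erase] at ht
      rcases Finset.mem_union.1 hx with hx | hx
      · exact ht.2.1 (P.eq_of_mem_parts ht.2.2 hA hxt hx)
      · exact ht.1 (P.eq_of_mem_parts ht.2.2 hB hxt hx)
    by_cases hx : x ∈ A ∪ B
    · refine ⟨A ∪ B, ⟨Finset.mem_insert_self _ _, hx⟩, ?_⟩
      rintro t ⟨ht, hxt⟩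
      rcases Finset.mem_insert.1 ht with rfl | ht
      · rfl
      · exact absurd hx (key t ht hxt)
    · refine ⟨P.part x, ⟨?_, P.self_mem_part_univ x⟩, ?_⟩
      · refine Finset.mem_insert_of_mem (Finset.mem_erase.2 ⟨?_, Finset.mem_erase.2 ⟨?_, ?_⟩⟩)
        · rintro rfl
          exact hx (Finset.mem_union_right _ (P.self_mem_part_univ x))
        · rintro rfl
          exact hx (Finset.mem_union_left _ (P.self_mem_part_univ x))
        · exact P.part_univ_mem x
      · rintro t ⟨ht, hxt⟩
        rcases Finset.mem_insert.1 ht with rfl | ht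
        · exact absurd hxt hx
        · simp only [Finset.mem_erase] at ht
          exact (P.part_eq_of_mem ht.2.2 hxt).symm
  · intro h
    rcases Finset.mem_insert.1 h with h | h
    · have := P.nonempty_of_mem_parts hA
      rw [eq_comm, Finset.union_eq_empty] at h
      exact this.ne_empty h.1
    · simp only [Finset.mem_erase] at h
      exact P.empty_notMem_parts h.2.2

lemma part_of_isMerge {P Q : Finpartition (Finset.univ : Finset V)} {A B : Finset V}
    (hQ : Q.parts = insert (A ∪ B) ((P.parts.erase A).erase B)) (x : V) :
    Q.part x = if P.part x = A ∨ P.part x = B then A ∪ B else P.part x := by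
  split_ifs with h
  · apply Q.part_eq_of_mem
    · rw [hQ]; exact Finset.mem_insert_self _ _
    · rcases h with h | h
      · exact Finset.mem_union_left _ (h ▸ P.self_mem_part_univ x)
      · exact Finset.mem_union_right _ (h ▸ P.self_mem_part_univ x)
  · push Not at h
    apply Q.part_eq_of_mem
    · rw [hQ]
      exact Finset.mem_insert_of_mem
        (Finset.mem_erase.2 ⟨h.2, Finset.mem_erase.2 ⟨h.1, P.part_univ_mem x⟩⟩)
    · exact P.self_mem_part_univ x

lemma card_parts_of_isMerge {P Q : Finpartition (Finset.univ : Finset V)} {A B : Finset V}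
    (hA : A ∈ P.parts) (hB : B ∈ P.parts) (hAB : A ≠ B)
    (hQ : Q.parts = insert (A ∪ B) ((P.parts.erase A).erase B)) :
    Q.parts.card < P.parts.card := by
  have h1 : ((P.parts.erase A).erase B).card + 1 = (P.parts.erase A).card :=
    Finset.card_erase_add_one (Finset.mem_erase.2 ⟨hAB.symm, hB⟩)
  have h2 : (P.parts.erase A).card + 1 = P.parts.card := Finset.card_erase_add_one hA
  have h3 := Finset.card_insert_le (A ∪ B) ((P.parts.erase A).erase B)
  rw [hQ]
  omega

/-- The partition `Q` is the last term of a sequence of partitions that starts with the singletons,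
merges two parts at a time, and in which all red degrees are at most `w`. -/
def ReachableWithin (G : SimpleGraph V) (w : ℕ)
    (Q : Finpartition (Finset.univ : Finset V)) : Prop :=
  ∃ (k : ℕ) (P : ℕ → Finpartition (Finset.univ : Finset V)),
    P 0 = ⊥ ∧ P k = Q ∧ (∀ i < k, IsMerge (P i) (P (i + 1))) ∧
      ∀ i ≤ k, ∀ A ∈ (P i).parts, redDegree G (P i) A ≤ w

lemma ReachableWithin.bot {G : SimpleGraph V} {w : ℕ}
    (h : ∀ A ∈ (⊥ : Finpartition (Finset.univ : Finset V)).parts, redDegree G ⊥ A ≤ w) :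
    ReachableWithin G w ⊥ :=
  ⟨0, fun _ => ⊥, rfl, rfl, by simp, fun _ _ => h⟩

lemma ReachableWithin.step {G : SimpleGraph V} {w : ℕ}
    {P Q : Finpartition (Finset.univ : Finset V)} (hP : ReachableWithin G w P)
    (hPQ : IsMerge P Q) (hQ : ∀ A ∈ Q.parts, redDegree G Q A ≤ w) : ReachableWithin G w Q := by
  obtain ⟨k, R, h0, hk, hmerge, hdeg⟩ := hP
  refine ⟨k + 1, fun i => if i ≤ k then R i else Q, by simpa using h0, by simp, ?_, ?_⟩
  · intro i hi
    rcases Nat.lt_succ_iff_lt_or_eq.1 hi with h | rfl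
    · have h1 : i ≤ k := h.le
      have h2 : i + 1 ≤ k := h
      simpa only [h1, h2, if_true] using hmerge i h
    · simpa [hk] using hPQ
  · intro i hi A hA
    by_cases h : i ≤ k
    · simp only [h, if_true] at hA ⊢
      exact hdeg i h A hA
    · simp only [h, if_false] at hA ⊢
      exact hQ A hA

/-- From a reachable partition one reaches every coarser one (given as the kernel of `f`),
provided that all partitions in between have red degree at most `w`. -/
lemma ReachableWithin.coarsen {G : SimpleGraph V} {w : ℕ} {β : Type*} (f : V → β)
    (P : Finpartition (Finset.univ : Finset V)) (hP : ReachableWithin G w P)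
    (hPf : ∀ x y, P.part x = P.part y → f x = f y)
    (hdeg : ∀ R : Finpartition (Finset.univ : Finset V),
      (∀ x y, P.part x = P.part y → R.part x = R.part y) →
      (∀ x y, R.part x = R.part y → f x = f y) → ∀ A ∈ R.parts, redDegree G R A ≤ w) :
    ∃ Q, ReachableWithin G w Q ∧ ∀ x y, Q.part x = Q.part y ↔ f x = f y := by
  induction hn : P.parts.card using Nat.strong_induction_on generalizing P with
  | _ n ih =>
  by_cases h : ∀ x y, f x = f y → P.part x = P.part y
  · exact ⟨P, hP, fun x y => ⟨hPf x y, h x y⟩⟩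
  push Not at h
  obtain ⟨a, b, hfab, hab⟩ := h
  have ha := P.part_univ_mem a
  have hb := P.part_univ_mem b
  obtain ⟨Q, hQ⟩ := exists_isMerge P ha hb hab
  have hpart := part_of_isMerge hQ
  have hcoarse : ∀ x y, P.part x = P.part y → Q.part x = Q.part y := by
    intro x y hxy
    rw [hpart x, hpart y, hxy]
  have hQf : ∀ x y, Q.part x = Q.part y → f x = f y := by
    intro x y hxy
    have hcls : ∀ z, (P.part z = P.part a ∨ P.part z = P.part b) → f z = f a := by
      rintro z (hz | hz)
      · exact hPf z a hz
      · exact (hPf z b hz).trans hfab.symm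
    have hmem : ∀ z, z ∈ P.part a ∪ P.part b → P.part z = P.part a ∨ P.part z = P.part b := by
      intro z hz
      rcases Finset.mem_union.1 hz with hz | hz
      · exact Or.inl (P.part_eq_of_mem ha hz)
      · exact Or.inr (P.part_eq_of_mem hb hz)
    rw [hpart x, hpart y] at hxy
    split_ifs at hxy with h1 h2 h2
    · rw [hcls x h1, hcls y h2]
    · rw [hcls x h1, hcls y (hmem y (hxy ▸ P.self_mem_part_univ y))]
    · rw [hcls y h2, hcls x (hmem x (hxy ▸ P.self_mem_part_univ x))]
    · exact hPf x y hxy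
  refine ih _ ?_ Q (hP.step ⟨_, ha, _, hb, hab, hQ⟩ (hdeg Q hcoarse hQf)) hQf ?_ rfl
  · rw [← hn]
    exact card_parts_of_isMerge ha hb hab hQ
  · intro R hR hRf
    exact hdeg R (fun x y hxy => hR x y (hcoarse x y hxy)) hRf

lemma ReachableWithin.hasContractionSequence {G : SimpleGraph V} {w : ℕ}
    {Q : Finpartition (Finset.univ : Finset V)} (hQ : ReachableWithin G w Q)
    (h : ∀ x y, Q.part x = Q.part y) : HasContractionSequence G w := by
  obtain ⟨k, P, h0, hk, hmerge, hdeg⟩ := hQ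
  refine ⟨k, P, h0, ?_, hmerge, hdeg⟩
  rw [hk, Finset.card_le_one]
  intro A hA B hB
  obtain ⟨a, ha⟩ := Q.nonempty_of_mem_parts hA
  obtain ⟨b, hb⟩ := Q.nonempty_of_mem_parts hB
  rw [← Q.part_eq_of_mem hA ha, ← Q.part_eq_of_mem hB hb, h a b]

/-- The red degree of a part is at most the number of values that a function refining the partition
takes on the neighbourhood of the part. -/
lemma redDegree_le_card {G : SimpleGraph V} {β : Type*} (f : V → β)
    (R : Finpartition (Finset.univ : Finset V))
    (hf : ∀ x y, f x = f y → R.part x = R.part y) {A : Finset V} (T : Finset β)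
    (hT : ∀ a ∈ A, ∀ b, G.Adj a b → f b ∈ T) :
    redDegree G R A ≤ T.card := by
  classical
  have hsub : {B : Finset V | B ∈ R.parts ∧ RedAdj G A B} ⊆
      ((fun t : β => if h : ∃ b, f b = t then R.part h.choose else ∅) '' (T : Set β)) := by
    rintro B ⟨hB, -, -, hadj⟩
    push Not at hadj
    obtain ⟨a, ha, b, hb, hab⟩ := hadj
    refine ⟨f b, hT a ha b hab, ?_⟩
    have h : ∃ b', f b' = f b := ⟨b, rfl⟩
    simp only [h, dite_true]
    rw [hf _ _ h.choose_spec, R.part_eq_of_mem hB hb]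
  calc redDegree G R A ≤ Set.ncard (_ '' (T : Set β)) :=
        Set.ncard_le_ncard hsub ((Finset.finite_toSet T).image _)
    _ ≤ (T : Set β).ncard := Set.ncard_image_le (Finset.finite_toSet T)
    _ = T.card := Set.ncard_coe_finset T

lemma hasContractionSequence_card (G : SimpleGraph V) :
    HasContractionSequence G (Fintype.card V) := by
  have hdeg : ∀ R : Finpartition (Finset.univ : Finset V), ∀ A ∈ R.parts,
      redDegree G R A ≤ Fintype.card V := fun R A _ =>
    redDegree_le_card (fun x => x) R (fun x y h => by rw [h]) Finset.univ (by simp)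
  obtain ⟨Q, hQ, hker⟩ := (ReachableWithin.bot (hdeg ⊥)).coarsen (fun _ => ()) ⊥ (by simp)
    (fun R _ _ => hdeg R)
  exact hQ.hasContractionSequence (fun x y => (hker x y).2 rfl)

lemma hasContractionSequence_twinWidth (G : SimpleGraph V) :
    HasContractionSequence G (twinWidth G) :=
  Nat.sInf_mem (s := {w : ℕ | HasContractionSequence G w}) ⟨_, hasContractionSequence_card G⟩

lemma HasContractionSequence.twinWidth_le {G : SimpleGraph V} {w : ℕ}
    (h : HasContractionSequence G w) : twinWidth G ≤ w :=
  Nat.sInf_le h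

lemma HasContractionSequence.mono {G : SimpleGraph V} {w w' : ℕ}
    (h : HasContractionSequence G w) (hw : w ≤ w') : HasContractionSequence G w' := by
  obtain ⟨k, P, h0, hk, hmerge, hdeg⟩ := h
  exact ⟨k, P, h0, hk, hmerge, fun i hi A hA => (hdeg i hi A hA).trans hw⟩

lemma twinWidth_le_card (G : SimpleGraph V) : twinWidth G ≤ Fintype.card V :=
  (hasContractionSequence_card G).twinWidth_le

end Contraction

/-! ### Cutting the cycles of a permutation into short segments -/

/-- Any function has the same kernel as some self-map of its domain. -/
lemma exists_endo_ker_eq {α β : Type*} (f : α → β) :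
    ∃ g : α → α, ∀ a b, g a = g b ↔ f a = f b := by
  have h : ∀ a, ∃ b, f b = f a := fun a => ⟨a, rfl⟩
  obtain hα | hα := isEmpty_or_nonempty α
  · exact ⟨id, fun a => hα.elim a⟩
  refine ⟨fun a => Function.invFun f (f a), fun a b => ⟨fun hab => ?_, fun hab => by
    change Function.invFun f (f a) = Function.invFun f (f b)
    rw [hab]⟩⟩
  rw [← Function.invFun_eq (h a), ← Function.invFun_eq (h b)]
  exact congrArg f hab

/-- The elements of a cycle whose positions lie in a block of length `D`. -/
lemma card_block_le {α : Type*} {D : ℕ} (hD : 0 < D) (base : α → α) (pos : α → ℕ)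
    (hinj : ∀ a b, base a = base b → pos a = pos b → a = b) (c : α) (k q : ℕ) (s : Finset α)
    (hs : ∀ a ∈ s, base a = c ∧ (pos a + k) / D = q) : s.card ≤ D := by
  have : s.card ≤ (Finset.Ico (q * D) (q * D + D)).card := by
    apply Finset.card_le_card_of_injOn (fun a => pos a + k)
    · intro a ha
      obtain ⟨-, h⟩ := hs a ha
      have h1 := Nat.div_add_mod (pos a + k) D
      have h2 := Nat.mod_lt (pos a + k) hD
      rw [h, mul_comm] at h1
      simp only [Finset.coe_Ico, Set.mem_Ico]
      omega
    · intro a ha b hb hab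
      simp only at hab
      exact hinj a b ((hs a ha).1.trans (hs b hb).1.symm) (by omega)
  simpa using this

section Cut

variable {α : Type*} [Fintype α] [DecidableEq α]

/-- Positions along the cycles of a permutation: `pos` increases by one along `σ`, except that it
drops from its maximum to `0` at the end of each cycle. -/
lemma Equiv.Perm.exists_position (σ : Equiv.Perm α) :
    ∃ (base : α → α) (pos : α → ℕ), (∀ a, base (σ a) = base a) ∧
      (∀ a, pos (σ a) = pos a + 1 ∨ (pos (σ a) = 0 ∧ ∀ b, base b = base a → pos b ≤ pos a)) ∧
      ∀ a b, base a = base b → pos a = pos b → a = b := by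
  let base : α → α := fun a => Quotient.out (Quotient.mk (Equiv.Perm.SameCycle.setoid σ) a)
  have hsame : ∀ a, σ.SameCycle (base a) a := fun a =>
    Quotient.exact (s := Equiv.Perm.SameCycle.setoid σ) (Quotient.out_eq _)
  have hex : ∀ a, ∃ j : ℕ, (σ ^ j) (base a) = a := fun a => (hsame a).exists_nat_pow_eq
  have hbase : ∀ a, base (σ a) = base a := by
    intro a
    have : (Quotient.mk (Equiv.Perm.SameCycle.setoid σ) (σ a)) =
        Quotient.mk (Equiv.Perm.SameCycle.setoid σ) a :=
      Quotient.sound (s := Equiv.Perm.SameCycle.setoid σ)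
        (Equiv.Perm.sameCycle_apply_left.2 (Equiv.Perm.SameCycle.refl σ a))
    simp only [base, this]
  let pos : α → ℕ := fun a => Nat.find (hex a)
  have hpos : ∀ a, (σ ^ pos a) (base a) = a := fun a => Nat.find_spec (hex a)
  have hmin : ∀ a j, (σ ^ j) (base a) = a → pos a ≤ j := fun a j h => Nat.find_min' (hex a) h
  refine ⟨base, pos, hbase, ?_, ?_⟩
  · intro a
    have h1 : pos (σ a) ≤ pos a + 1 := by
      apply hmin
      rw [hbase, pow_succ', Equiv.Perm.mul_apply, hpos]
    rcases Nat.eq_zero_or_pos (pos (σ a)) with h0 | h0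
    · right
      refine ⟨h0, fun b hb => ?_⟩
      by_contra! hlt
      have hfix : (σ ^ (pos a + 1)) (base a) = base a := by
        rw [pow_succ', Equiv.Perm.mul_apply, hpos]
        have := hpos (σ a)
        rw [h0, pow_zero, Equiv.Perm.one_apply, hbase] at this
        exact this.symm
      have hb' := hpos b
      obtain ⟨c, hc⟩ := Nat.exists_eq_add_of_lt hlt
      have : pos b ≤ c := by
        apply hmin
        rw [show pos b = c + (pos a + 1) by omega, pow_add, Equiv.Perm.mul_apply, hb, hfix,
          ← hb] at hb'
        exact hb'
      omega
    · left
      obtain ⟨i, hi⟩ := Nat.exists_eq_succ_of_ne_zero h0.ne'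
      have : pos a ≤ i := by
        apply hmin
        have h2 := hpos (σ a)
        rw [hi, Nat.succ_eq_add_one, pow_succ', Equiv.Perm.mul_apply, hbase] at h2
        exact σ.injective h2
      omega
  · intro a b h1 h2
    rw [← hpos a, ← hpos b, h1, h2]

/-- `D` ways of cutting the cycles of `σ` into segments of length at most `2 * D`, such that each
step `a ↦ σ a` is cut at most once. The `k`-th way uses blocks of `D` consecutive positions, shifted
by `k`, where the last block of each cycle is joined to the first one, so that the step closing
the cycle is never cut. -/
lemma Equiv.Perm.exists_segments (σ : Equiv.Perm α) {D : ℕ} (hD : 0 < D) :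
    ∃ r : Fin D → α → α,
      (∀ k c, (Finset.univ.filter fun a => r k a = c).card ≤ 2 * D) ∧
        ∀ a, (Finset.univ.filter fun k => r k (σ a) ≠ r k a).card ≤ 1 := by
  obtain ⟨base, pos, hbase, hstep, hinj⟩ := σ.exists_position
  let M : α → ℕ := fun c => (Finset.univ.filter fun a => base a = c).sup pos
  have hM : ∀ a, pos a ≤ M (base a) := fun a =>
    Finset.le_sup (f := pos) (Finset.mem_filter.2 ⟨Finset.mem_univ a, rfl⟩)
  let R : Fin D → α → α × ℕ := fun k a =>
    (base a, if (pos a + k) / D = (M (base a) + k) / D then 0 else (pos a + k) / D)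
  choose r hr using fun k => exists_endo_ker_eq (R k)
  refine ⟨r, ?_, ?_⟩
  · intro k c
    rcases (Finset.univ.filter fun a => r k a = c).eq_empty_or_nonempty with he | ⟨a₀, ha₀⟩
    · simp [he]
    have hc : ∀ a ∈ (Finset.univ.filter fun a => r k a = c), R k a = R k a₀ := by
      intro a ha
      rw [← hr, (Finset.mem_filter.1 ha).2, (Finset.mem_filter.1 ha₀).2]
    set s := Finset.univ.filter fun a => r k a = c
    have h1 := card_block_le hD base pos hinj (base a₀) k ((M (base a₀) + k) / D)
      (s.filter fun a => (pos a + k) / D = (M (base a₀) + k) / D) (by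
        intro a ha
        rw [Finset.mem_filter] at ha
        exact ⟨congrArg Prod.fst (hc a ha.1), ha.2⟩)
    have h2 := card_block_le hD base pos hinj (base a₀) k (R k a₀).2
      (s.filter fun a => ¬ (pos a + k) / D = (M (base a₀) + k) / D) (by
        intro a ha
        rw [Finset.mem_filter] at ha
        have h3 := hc a ha.1
        have h4 : base a = base a₀ := congrArg Prod.fst h3
        refine ⟨h4, ?_⟩
        rw [← h3]
        simp only [R, h4, ha.2, if_false])
    rw [← Finset.card_filter_add_card_filter_not
      (fun a => (pos a + k) / D = (M (base a₀) + k) / D)]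
    omega
  · intro a
    rw [Finset.card_le_one]
    have hdvd : ∀ k ∈ (Finset.univ.filter fun k => r k (σ a) ≠ r k a), D ∣ pos a + 1 + k := by
      intro k hk
      have hne : R k (σ a) ≠ R k a := fun h => (Finset.mem_filter.1 hk).2 ((hr k _ _).2 h)
      by_contra hnd
      apply hne
      have h1 : base (σ a) = base a := hbase a
      rcases hstep a with h2 | ⟨h2, h3⟩
      · have h4 : (pos (σ a) + k) / D = (pos a + k) / D := by
          rw [h2, show pos a + 1 + (k : ℕ) = pos a + k + 1 by ring, Nat.succ_div_of_not_dvd]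
          rwa [show pos a + (k : ℕ) + 1 = pos a + 1 + k by ring]
        simp only [R, h1, h4]
      · have h5 : pos a = M (base a) := le_antisymm (hM a) (Finset.sup_le fun b hb =>
          h3 b (Finset.mem_filter.1 hb).2)
        have h6 : (k : ℕ) / D = 0 := Nat.div_eq_of_lt k.2
        simp [R, h1, h2, h5, h6]
    intro k hk l hl
    have h1 := hdvd k hk
    have h2 := hdvd l hl
    have h3 : (k : ℕ) ≡ l [MOD D] := by
      have h4 : pos a + 1 + (k : ℕ) ≡ pos a + 1 + l [MOD D] :=
        ((Nat.modEq_zero_iff_dvd).2 h1).trans ((Nat.modEq_zero_iff_dvd).2 h2).symm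
      exact Nat.ModEq.add_left_cancel' _ h4
    exact Fin.ext (h3.eq_of_lt_of_lt k.2 l.2)

end Cut

lemma finRotate_apply_ne {d : ℕ} (hd : 2 ≤ d) (i : Fin d) : finRotate d i ≠ i := by
  obtain ⟨k, rfl⟩ := Nat.exists_eq_add_of_le' hd
  rw [finRotate_apply]
  intro h
  simp at h

/-- A function all of whose fibres have `d ≥ 2` elements is preserved by some permutation without
fixed points. -/
lemma exists_perm_fibrewise_ne {α β : Type*} [Fintype α] [DecidableEq β] (f : α → β) {d : ℕ}
    (hd : 2 ≤ d) (hf : ∀ b, (Finset.univ.filter fun a => f a = b).card = d) :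
    ∃ σ : Equiv.Perm α, ∀ a, f (σ a) = f a ∧ σ a ≠ a := by
  have e : ∀ b, {a // f a = b} ≃ Fin d := fun b => Fintype.equivFinOfCardEq (by
    rw [Fintype.card_subtype, hf b])
  let E : α ≃ Σ b : β, Fin d := (Equiv.sigmaFiberEquiv f).symm.trans (Equiv.sigmaCongrRight e)
  have hE : ∀ a, (E a).1 = f a := fun a => rfl
  refine ⟨(E.trans (Equiv.sigmaCongrRight fun _ => finRotate d)).trans E.symm, fun a => ⟨?_, ?_⟩⟩
  · rw [← hE, ← hE]
    simp [Equiv.sigmaCongrRight]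
  · intro h
    have h1 : (Equiv.sigmaCongrRight fun _ : β => finRotate d) (E a) = E a := by
      rw [Equiv.trans_apply, Equiv.trans_apply, Equiv.symm_apply_eq] at h
      exact h
    have h2 := Sigma.ext_iff.1 h1
    exact finRotate_apply_ne hd (E a).2 (eq_of_heq h2.2)

/-! ### Covering the edges of a regular graph by small vertex sets -/

/-- The covering sets that contain `v`. A visit `a` takes place at the vertex `vtx a`, and `r k a` is
the segment to which it belongs in the `k`-th way of cutting. The index `(k, c, false)` stands for
the set of vertices visited by the segment `c`, and `(k, c, true)` for the set of those visited at
least twice. -/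
noncomputable def visitSets {V α κ : Type*} [DecidableEq V] [Fintype α] [DecidableEq α]
    [Fintype κ] [DecidableEq κ] (vtx : α → V) (r : κ → α → α) (v : V) : Finset (κ × α × Bool) :=
  Finset.univ.filter fun ω =>
    (if ω.2.2 then 2 else 1) ≤ (Finset.univ.filter fun a => vtx a = v ∧ r ω.1 a = ω.2.1).card

/-- A vertex with `d` visits lies in at most `d` sets for each way of cutting: a segment with `j ≥ 1`
visits at the vertex contributes `min j 2` sets. -/
lemma card_visitSets_le {V α κ : Type*} [DecidableEq V] [Fintype α] [DecidableEq α]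
    [Fintype κ] [DecidableEq κ] (vtx : α → V) (r : κ → α → α) (v : V) :
    (visitSets vtx r v).card ≤
      Fintype.card κ * (Finset.univ.filter fun a => vtx a = v).card := by
  have h1 : (visitSets vtx r v).card =
      ∑ k : κ, ∑ c : α, ∑ b : Bool, if (if b then 2 else 1) ≤
        (Finset.univ.filter fun a => vtx a = v ∧ r k a = c).card then 1 else 0 := by
    rw [visitSets, Finset.card_filter, Fintype.sum_prod_type]
    refine Finset.sum_congr rfl fun k _ => ?_
    rw [Fintype.sum_prod_type]
  rw [h1, ← smul_eq_mul, ← Finset.card_univ, ← Finset.sum_const]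
  refine Finset.sum_le_sum fun k _ => ?_
  have h2 : (Finset.univ.filter fun a => vtx a = v).card =
      ∑ c : α, (Finset.univ.filter fun a => vtx a = v ∧ r k a = c).card := by
    rw [Finset.card_eq_sum_card_fiberwise (f := r k) (t := Finset.univ) (by simp)]
    refine Finset.sum_congr rfl fun c _ => ?_
    rw [Finset.filter_filter]
  rw [h2]
  refine Finset.sum_le_sum fun c _ => ?_
  rw [Fintype.sum_bool]
  simp only [if_true, Bool.false_eq_true, if_false]
  split_ifs <;> omega

lemma card_filter_mem_visitSets_le {V α κ : Type*} [Fintype V] [DecidableEq V]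
    [Fintype α] [DecidableEq α] [Fintype κ] [DecidableEq κ]
    (vtx : α → V) (r : κ → α → α) (ω : κ × α × Bool) :
    (Finset.univ.filter fun v => ω ∈ visitSets vtx r v).card ≤
      (Finset.univ.filter fun a => r ω.1 a = ω.2.1).card := by
  refine (Finset.card_le_card ?_).trans (Finset.card_image_le (f := vtx))
  intro v hv
  simp only [visitSets, Finset.mem_filter, Finset.mem_univ, true_and] at hv
  have h1 : 0 < (Finset.univ.filter fun a => vtx a = v ∧ r ω.1 a = ω.2.1).card := by
    split_ifs at hv <;> omega
  obtain ⟨a, ha⟩ := Finset.card_pos.1 h1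
  simp only [Finset.mem_filter, Finset.mem_univ, true_and] at ha
  simp only [Finset.mem_image, Finset.mem_filter, Finset.mem_univ, true_and]
  exact ⟨a, ha.2, ha.1⟩

/-- Two vertices joined by two disjoint pairs of visits, each within a segment, have at least two
sets in common: the visits lie in two different segments, or they are in the same segment, which
then visits both vertices twice. -/
lemma two_le_card_inter_visitSets {V α κ : Type*} [DecidableEq V]
    [Fintype α] [DecidableEq α] [Fintype κ] [DecidableEq κ]
    (vtx : α → V) (r : κ → α → α) {u v : V} {a₁ a₂ b₁ b₂ : α}
    (ha₁ : vtx a₁ = u) (hb₁ : vtx b₁ = u) (ha₂ : vtx a₂ = v) (hb₂ : vtx b₂ = v)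
    (h₁ : a₁ ≠ b₁) (h₂ : a₂ ≠ b₂) {k : κ} (hka : r k a₁ = r k a₂) (hkb : r k b₁ = r k b₂) :
    2 ≤ ((visitSets vtx r u ∩ visitSets vtx r v).filter fun ω => ω.1 = k).card := by
  have hone : ∀ (w : V) (a : α), vtx a = w → (k, r k a, false) ∈ visitSets vtx r w := by
    intro w a ha
    simp only [visitSets, Finset.mem_filter, Finset.mem_univ, true_and, Bool.false_eq_true,
      if_false]
    exact Finset.card_pos.2 ⟨a, by simp [ha]⟩
  have htwo : ∀ (w : V) (a b : α), vtx a = w → vtx b = w → a ≠ b → r k a = r k b →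
      (k, r k a, true) ∈ visitSets vtx r w := by
    intro w a b ha hb hab hr
    simp only [visitSets, Finset.mem_filter, Finset.mem_univ, true_and, if_true]
    exact Finset.one_lt_card.2 ⟨a, by simp [ha], b, by simp [hb, hr], hab⟩
  apply Nat.succ_le_of_lt
  rw [Finset.one_lt_card]
  by_cases h : r k a₁ = r k b₁
  · refine ⟨(k, r k a₁, false), ?_, (k, r k a₁, true), ?_, by simp⟩
    · simp only [Finset.mem_filter, Finset.mem_inter, and_true]
      exact ⟨hone u a₁ ha₁, hka ▸ hone v a₂ ha₂⟩
    · simp only [Finset.mem_filter, Finset.mem_inter, and_true]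
      exact ⟨htwo u a₁ b₁ ha₁ hb₁ h₁ h,
        hka ▸ htwo v a₂ b₂ ha₂ hb₂ h₂ (by rw [← hka, h, hkb])⟩
  · refine ⟨(k, r k a₁, false), ?_, (k, r k b₁, false), ?_, by simp [h]⟩
    · simp only [Finset.mem_filter, Finset.mem_inter, and_true]
      exact ⟨hone u a₁ ha₁, hka ▸ hone v a₂ ha₂⟩
    · simp only [Finset.mem_filter, Finset.mem_inter, and_true]
      exact ⟨hone u b₁ hb₁, hkb ▸ hone v b₂ hb₂⟩

lemma two_mul_card_le_of_fibres {β κ : Type*} [DecidableEq κ] (I : Finset β) (f : β → κ)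
    (T : Finset κ) (h : ∀ k ∈ T, 2 ≤ (I.filter fun ω => f ω = k).card) : 2 * T.card ≤ I.card := by
  calc 2 * T.card = ∑ k ∈ T, 2 := by simp [mul_comm]
    _ ≤ ∑ k ∈ T, ((I.filter fun ω => f ω ∈ T).filter fun ω => f ω = k).card := by
        refine Finset.sum_le_sum fun k hk => (h k hk).trans (Finset.card_le_card fun ω hω => ?_)
        simp only [Finset.mem_filter] at hω ⊢
        exact ⟨⟨hω.1, hω.2 ▸ hk⟩, hω.2⟩
    _ = (I.filter fun ω => f ω ∈ T).card :=
        (Finset.card_eq_sum_card_fiberwise (f := f) (by simp [Set.MapsTo])).symm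
    _ ≤ I.card := Finset.card_filter_le _ _

/-- The covering sets before filling up: each vertex lies in at most `D * d` of them. -/
lemma exists_cover_sets_le {V : Type*} [Fintype V] [DecidableEq V] (G : SimpleGraph V)
    [DecidableRel G.Adj] {d : ℕ} (hd : 2 ≤ d) (hG : G.IsRegularOfDegree d) {D : ℕ} (hD : 0 < D) :
    ∃ S : V → Finset (Fin D × G.Dart × Bool),
      (∀ v, (S v).card ≤ D * d) ∧
      (∀ u v, G.Adj u v → 2 * (D - 2) ≤ (S u ∩ S v).card) ∧
      ∀ ω, (Finset.univ.filter fun v => ω ∈ S v).card ≤ 2 * D := by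
  have hfib : ∀ v, (Finset.univ.filter fun a : G.Dart => a.fst = v).card = d := fun v => by
    rw [G.dart_fst_fiber_card_eq_degree, hG v]
  obtain ⟨shift, hshift⟩ := exists_perm_fibrewise_ne (fun a : G.Dart => a.fst) hd hfib
  -- The visit `a` leaves along the dart `shift a`, and the next visit has the reverse of this dart.
  let rev : Equiv.Perm G.Dart := Function.Involutive.toPerm _ SimpleGraph.Dart.symm_involutive
  let σ : Equiv.Perm G.Dart := shift.trans rev
  obtain ⟨r, hr, hcut⟩ := σ.exists_segments hD
  refine ⟨visitSets (fun a : G.Dart => a.fst) r, ?_, ?_, ?_⟩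
  · intro v
    have := card_visitSets_le (fun a : G.Dart => a.fst) r v
    rwa [hfib, Fintype.card_fin] at this
  · intro u v huv
    let e : G.Dart := ⟨(u, v), huv⟩
    -- Each of the two darts of the edge `uv` joins a visit at one end with the next at the other.
    let a₁ := shift.symm e
    let b₂ := shift.symm e.symm
    have hσa : σ a₁ = e.symm := by
      simp only [σ, a₁, Equiv.trans_apply, Equiv.apply_symm_apply]; rfl
    have hσb : σ b₂ = e := by
      simp only [σ, b₂, Equiv.trans_apply, Equiv.apply_symm_apply]
      exact SimpleGraph.Dart.symm_symm e
    have ha₁ : a₁.fst = u := by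
      have := (hshift a₁).1
      simp only [a₁, Equiv.apply_symm_apply] at this
      exact this.symm
    have hb₂ : b₂.fst = v := by
      have := (hshift b₂).1
      simp only [b₂, Equiv.apply_symm_apply] at this
      exact this.symm
    have hne₁ : a₁ ≠ e := by
      have := (hshift a₁).2
      simp only [a₁, Equiv.apply_symm_apply] at this
      exact this.symm
    have hne₂ : e.symm ≠ b₂ := by
      have := (hshift b₂).2
      simpa only [b₂, Equiv.apply_symm_apply] using this
    let bad : Finset (Fin D) := (Finset.univ.filter fun k => r k (σ a₁) ≠ r k a₁) ∪
      (Finset.univ.filter fun k => r k (σ b₂) ≠ r k b₂)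
    have hbad : bad.card ≤ 2 :=
      (Finset.card_union_le _ _).trans (add_le_add (hcut a₁) (hcut b₂))
    have hgood : D - 2 ≤ (Finset.univ \ bad).card := by
      rw [Finset.card_sdiff_of_subset (Finset.subset_univ _), Finset.card_univ, Fintype.card_fin]
      omega
    refine (Nat.mul_le_mul_left 2 hgood).trans
      (two_mul_card_le_of_fibres _ (fun ω => ω.1) (Finset.univ \ bad) fun k hk => ?_)
    simp only [bad, Finset.mem_sdiff, Finset.mem_univ, true_and, Finset.mem_union,
      Finset.mem_filter, not_or, not_not] at hk
    exact two_le_card_inter_visitSets (fun a : G.Dart => a.fst) r (u := u) (v := v)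
      (a₁ := a₁) (a₂ := e.symm) (b₁ := e) (b₂ := b₂) ha₁ rfl rfl hb₂ hne₁ hne₂
      (by rw [← hk.1, hσa]) (by rw [← hk.2, hσb])
  · intro ω
    exact (card_filter_mem_visitSets_le _ r ω).trans (hr _ _)

/-- The edges of a `d`-regular graph can be covered by sets of at most `2 * D` vertices such that
each vertex lies in `D * d` of these sets and the two ends of each edge have at least
`2 * (D - 2)` of them in common. The sets are the values of the type `Ω`, and `S v` consists of
those that contain `v`. -/
lemma exists_cover_sets {V : Type*} [Fintype V] [DecidableEq V] (G : SimpleGraph V)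
    [DecidableRel G.Adj] {d : ℕ} (hd : 2 ≤ d) (hG : G.IsRegularOfDegree d) {D : ℕ} (hD : 0 < D) :
    ∃ S : V → Finset (Fin D × G.Dart × Bool ⊕ V × Fin (D * d)),
      (∀ v, (S v).card = D * d) ∧
      (∀ u v, G.Adj u v → 2 * (D - 2) ≤ (S u ∩ S v).card) ∧
      ∀ ω, (Finset.univ.filter fun v => ω ∈ S v).card ≤ 2 * D := by
  obtain ⟨S, h1, h2, h3⟩ := exists_cover_sets_le G hd hG hD
  -- Singletons, taken with multiplicity, fill up the number of sets at each vertex.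
  refine ⟨fun v => (S v).disjSum
    (Finset.univ.filter fun p => p.1 = v ∧ (p.2 : ℕ) < D * d - (S v).card), ?_, ?_, ?_⟩
  · intro v
    have h4 : (Finset.univ.filter fun p : V × Fin (D * d) =>
        p.1 = v ∧ (p.2 : ℕ) < D * d - (S v).card) =
        {v} ×ˢ (Finset.univ.filter fun i : Fin (D * d) => (i : ℕ) < D * d - (S v).card) := by
      ext ⟨x, i⟩
      simp only [Finset.mem_filter, Finset.mem_univ, true_and, Finset.mem_product,
        Finset.mem_singleton]
    rw [Finset.card_disjSum, h4, Finset.card_product, Finset.card_singleton, one_mul,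
      Fin.card_filter_val_lt]
    have := h1 v
    omega
  · intro u v huv
    refine (h2 u v huv).trans ?_
    rw [← Finset.card_map Function.Embedding.inl]
    apply Finset.card_le_card
    intro ω hω
    simp only [Finset.mem_map, Finset.mem_inter, Function.Embedding.inl_apply] at hω
    obtain ⟨a, ⟨ha, hb⟩, rfl⟩ := hω
    simp [ha, hb]
  · rintro (ω | ⟨x, i⟩)
    · simpa using h3 ω
    · refine le_trans (Finset.card_le_one.2 ?_) (by omega : 1 ≤ 2 * D)
      intro a ha b hb
      simp only [Finset.mem_filter, Finset.mem_univ, true_and, Finset.inr_mem_disjSum] at ha hb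
      rw [← ha.1, ← hb.1]

/-! ### Random labels of the covering sets -/

lemma card_filter_agree_mul {Ω : Type*} [Fintype Ω] [DecidableEq Ω] {M : ℕ} (A : Finset Ω)
    (f : Ω → Fin M) :
    (Finset.univ.filter fun φ : Ω → Fin M => ∀ ω ∈ A, φ ω = f ω).card * M ^ A.card =
      M ^ Fintype.card Ω := by
  have h1 : (Finset.univ.filter fun φ : Ω → Fin M => ∀ ω ∈ A, φ ω = f ω) =
      Fintype.piFinset fun ω => if ω ∈ A then {f ω} else Finset.univ := by
    ext φ
    simp only [Finset.mem_filter, Finset.mem_univ, true_and, Fintype.mem_piFinset]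
    refine forall_congr' fun ω => ?_
    split_ifs with h <;> simp [h]
  have h2 : ∀ ω : Ω, (if ω ∈ A then ({f ω} : Finset (Fin M)) else Finset.univ).card =
      if ω ∈ A then 1 else M := by
    intro ω
    split_ifs <;> simp
  rw [h1, Fintype.card_piFinset]
  simp_rw [h2]
  rw [Finset.prod_ite, Finset.prod_const_one, one_mul, Finset.prod_const, ← pow_add]
  congr 1
  have := Finset.card_filter_add_card_filter_not (s := (Finset.univ : Finset Ω)) (fun ω => ω ∈ A)
  rw [Finset.filter_univ_mem, Finset.card_univ] at this
  omega

/-- Greedy choice of sets that are pairwise disjoint. -/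
lemma exists_pairwise_disjoint_subset {V Ω : Type*} [DecidableEq V] [DecidableEq Ω]
    (S : V → Finset Ω) (hS : ∀ v, (S v).Nonempty) {C : ℕ} (hC0 : 0 < C) (s : ℕ) (F : Finset V)
    (hC : ∀ v ∈ F, (F.filter fun u => ¬ Disjoint (S u) (S v)).card ≤ C) (hF : C * s ≤ F.card) :
    ∃ T ⊆ F, T.card = s ∧ (T : Set V).PairwiseDisjoint S := by
  induction s generalizing F with
  | zero => exact ⟨∅, by simp, by simp, by simp⟩
  | succ s ih =>
    have hFpos : 0 < F.card := by
      refine lt_of_lt_of_le ?_ hF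
      positivity
    obtain ⟨v, hv⟩ := Finset.card_pos.1 hFpos
    have hsplit := Finset.card_filter_add_card_filter_not (s := F)
      (fun u => Disjoint (S u) (S v))
    have hv' := hC v hv
    obtain ⟨T, hTF, hTs, hT⟩ := ih (F.filter fun u => Disjoint (S u) (S v))
      (fun u hu => (Finset.card_le_card
        (Finset.filter_subset_filter _ (Finset.filter_subset _ _))).trans
        (hC u (Finset.mem_filter.1 hu).1)) (by rw [Nat.mul_succ] at hF; omega)
    have hdisj : ∀ u ∈ T, Disjoint (S u) (S v) := fun u hu => (Finset.mem_filter.1 (hTF hu)).2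
    have hvT : v ∉ T := fun h => (hS v).ne_empty (disjoint_self.1 (hdisj v h))
    refine ⟨insert v T, ?_, by rw [Finset.card_insert_of_notMem hvT, hTs], ?_⟩
    · exact Finset.insert_subset hv (hTF.trans (Finset.filter_subset _ _))
    · rw [Finset.coe_insert]
      exact hT.insert fun u hu _ => (hdisj u hu).symm

/-- If the number `M ^ K` of label vectors is not too large, there are labels of the covering
sets for which no label vector is shared by many vertices: the expected number of families of `s`
vertices in pairwise disjoint covering sets, all with the same label vector, is less than one. -/
lemma exists_balanced_labelling {V Ω : Type*} [Fintype V] [DecidableEq V] [Fintype Ω]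
    [DecidableEq Ω] {K L M s : ℕ} (hK : 0 < K) (hL : 0 < L) (hM : 0 < M)
    (S : V → Finset Ω) (hS : ∀ v, (S v).card = K)
    (hSL : ∀ ω, (Finset.univ.filter fun v => ω ∈ S v).card ≤ L)
    (e : V → Fin K → Ω) (he : ∀ v ω, ω ∈ S v ↔ ∃ p, e v p = ω)
    (hs : (Fintype.card V).choose s * M ^ K < (M ^ K) ^ s) :
    ∃ φ : Ω → Fin M, ∀ x : Fin K → Fin M,
      (Finset.univ.filter fun v => ∀ p, φ (e v p) = x p).card ≤ K * L * s := by
  classical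
  by_contra! hcon
  let Ts : Finset (Finset V) :=
    (Finset.powersetCard s Finset.univ).filter fun T => (T : Set V).PairwiseDisjoint S
  let bad : Finset V × (Fin K → Fin M) → Finset (Ω → Fin M) := fun Tx =>
    Finset.univ.filter fun φ => ∀ v ∈ Tx.1, ∀ p, φ (e v p) = Tx.2 p
  have hnonempty : ∀ v, (S v).Nonempty := fun v => Finset.card_pos.1 (by rw [hS]; exact hK)
  have hcover : (Finset.univ : Finset (Ω → Fin M)) ⊆ (Ts ×ˢ Finset.univ).biUnion bad := by
    intro φ _
    obtain ⟨x, hx⟩ := hcon φ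
    obtain ⟨T, hTF, hTs, hT⟩ := exists_pairwise_disjoint_subset S hnonempty
      (Nat.mul_pos hK hL) s (Finset.univ.filter fun v => ∀ p, φ (e v p) = x p) (by
        intro v _
        calc _ ≤ ((S v).biUnion fun ω => Finset.univ.filter fun u => ω ∈ S u).card := by
              apply Finset.card_le_card
              intro u hu
              obtain ⟨ω, hω₁, hω₂⟩ := Finset.not_disjoint_iff.1 (Finset.mem_filter.1 hu).2
              simp only [Finset.mem_biUnion, Finset.mem_filter, Finset.mem_univ, true_and]
              exact ⟨ω, hω₂, hω₁⟩
          _ ≤ (S v).card * L := Finset.card_biUnion_le_card_mul _ _ _ fun ω _ => hSL ω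
          _ = K * L := by rw [hS]) hx.le
    simp only [Finset.mem_biUnion, Finset.mem_product, Finset.mem_univ, and_true]
    refine ⟨(T, x), ?_, ?_⟩
    · simp only [Ts, Finset.mem_filter, Finset.mem_powersetCard]
      exact ⟨⟨Finset.subset_univ _, hTs⟩, hT⟩
    · simp only [bad, Finset.mem_filter, Finset.mem_univ, true_and]
      intro v hv
      exact (Finset.mem_filter.1 (hTF hv)).2
  have hbad : ∀ Tx ∈ Ts ×ˢ (Finset.univ : Finset (Fin K → Fin M)),
      (bad Tx).card * (M ^ K) ^ s ≤ M ^ Fintype.card Ω := by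
    rintro ⟨T, x⟩ hTx
    simp only [Ts, Finset.mem_product, Finset.mem_filter, Finset.mem_powersetCard,
      Finset.mem_univ, and_true] at hTx
    obtain ⟨⟨-, hTs⟩, hT⟩ := hTx
    rcases (bad (T, x)).eq_empty_or_nonempty with h | ⟨φ₀, hφ₀⟩
    · simp [h]
    have hcard : (T.biUnion S).card = K * s := by
      rw [Finset.card_biUnion fun u hu v hv huv => hT hu hv huv]
      simp [hS, hTs, mul_comm]
    rw [← card_filter_agree_mul (T.biUnion S) φ₀, hcard, pow_mul]
    refine Nat.mul_le_mul_right _ (Finset.card_le_card ?_)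
    intro φ hφ
    simp only [bad, Finset.mem_filter, Finset.mem_univ, true_and] at hφ hφ₀ ⊢
    intro ω hω
    obtain ⟨v, hv, hωv⟩ := Finset.mem_biUnion.1 hω
    obtain ⟨p, rfl⟩ := (he v ω).1 hωv
    rw [hφ v hv p, hφ₀ v hv p]
  have hTcard : Ts.card ≤ (Fintype.card V).choose s := by
    refine (Finset.card_filter_le _ _).trans ?_
    rw [Finset.card_powersetCard, Finset.card_univ]
  have htotal : M ^ Fintype.card Ω * (M ^ K) ^ s ≤
      (Fintype.card V).choose s * M ^ K * M ^ Fintype.card Ω := by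
    calc M ^ Fintype.card Ω * (M ^ K) ^ s
        = (Finset.univ : Finset (Ω → Fin M)).card * (M ^ K) ^ s := by
          simp [Finset.card_univ]
      _ ≤ (∑ Tx ∈ Ts ×ˢ Finset.univ, (bad Tx).card) * (M ^ K) ^ s :=
          Nat.mul_le_mul_right _ ((Finset.card_le_card hcover).trans Finset.card_biUnion_le)
      _ = ∑ Tx ∈ Ts ×ˢ Finset.univ, (bad Tx).card * (M ^ K) ^ s := Finset.sum_mul _ _ _
      _ ≤ ∑ Tx ∈ Ts ×ˢ (Finset.univ : Finset (Fin K → Fin M)), M ^ Fintype.card Ω :=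
          Finset.sum_le_sum hbad
      _ = Ts.card * M ^ K * M ^ Fintype.card Ω := by
          simp [Finset.card_product, Finset.card_univ]
      _ ≤ _ := by gcongr
  have hpos : 0 < M ^ Fintype.card Ω := by positivity
  have := Nat.mul_lt_mul_of_pos_right hs hpos
  rw [mul_comm ((M ^ K) ^ s)] at this
  omega

/-- For a vector `x` of `K` labels, the number of label vectors with at least `t` entries
occurring in `x` is at most `(K + 1) ^ K * M ^ (K - t)`. -/
lemma exists_vectors_sharing_labels {K M : ℕ} (hM : 0 < M) (t : ℕ) (x : Fin K → ℕ) :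
    ∃ T : Finset (Fin K → ℕ), T.card ≤ (K + 1) ^ K * M ^ (K - t) ∧
      ∀ z : Fin K → ℕ, (∀ q, z q < M) →
        (∃ Q : Finset (Fin K), t ≤ Q.card ∧ ∀ q ∈ Q, ∃ p, z q = x p) → z ∈ T := by
  classical
  let A : (Fin K → Option (Fin K)) → Finset (Fin K → ℕ) := fun c =>
    Fintype.piFinset fun q => (c q).elim (Finset.range M) fun p => {x p}
  let C : Finset (Fin K → Option (Fin K)) :=
    Finset.univ.filter fun c => t ≤ (Finset.univ.filter fun q => c q ≠ none).card
  refine ⟨C.biUnion A, ?_, ?_⟩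
  · calc (C.biUnion A).card ≤ C.card * M ^ (K - t) := by
          refine Finset.card_biUnion_le_card_mul _ _ _ fun c hc => ?_
          have h1 : ∀ q, ((c q).elim (Finset.range M) fun p => {x p}).card =
              if c q ≠ none then 1 else M := by
            intro q
            cases c q <;> simp
          simp only [A, Fintype.card_piFinset]
          simp_rw [h1]
          rw [Finset.prod_ite, Finset.prod_const_one, one_mul, Finset.prod_const]
          apply Nat.pow_le_pow_right hM
          have h2 := (Finset.mem_filter.1 hc).2
          have h3 := Finset.card_filter_add_card_filter_not (s := (Finset.univ : Finset (Fin K)))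
            (fun q => c q ≠ none)
          rw [Finset.card_univ, Fintype.card_fin] at h3
          omega
      _ ≤ (K + 1) ^ K * M ^ (K - t) := by
          refine Nat.mul_le_mul_right _ ((Finset.card_le_univ _).trans ?_)
          simp
  · rintro z hz ⟨Q, hQ, hzx⟩
    choose! g hg using hzx
    rw [Finset.mem_biUnion]
    refine ⟨fun q => if q ∈ Q then some (g q) else none, ?_, ?_⟩
    · simp only [C, Finset.mem_filter, Finset.mem_univ, true_and]
      refine hQ.trans (Finset.card_le_card fun q hq => ?_)
      simp [hq]
    · simp only [A, Fintype.mem_piFinset]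
      intro q
      by_cases hq : q ∈ Q
      · simp [hq, hg q hq]
      · simp [hq, hz q]

lemma card_halves_le {K : ℕ} (x : Fin K → ℕ) :
    ∃ T : Finset (Fin K → ℕ), T.card ≤ 2 ^ K ∧ ∀ z : Fin K → ℕ, (∀ q, z q / 2 = x q) → z ∈ T := by
  refine ⟨Fintype.piFinset fun q => {2 * x q, 2 * x q + 1}, ?_, ?_⟩
  · rw [Fintype.card_piFinset]
    calc ∏ q, ({2 * x q, 2 * x q + 1} : Finset ℕ).card ≤ ∏ _q : Fin K, 2 :=
          Finset.prod_le_prod' fun q _ => Finset.card_le_two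
      _ = 2 ^ K := by simp
  · intro z hz
    rw [Fintype.mem_piFinset]
    intro q
    have := hz q
    simp only [Finset.mem_insert, Finset.mem_singleton]
    omega

/-- The twin-width of a graph covered by small sets is controlled by the sizes of the fibres of a
random labelling (until each part consists of the vertices with a given label vector), and then
by the number of label vectors that share at least `t` labels with a given one. -/
theorem hasContractionSequence_of_cover {V Ω : Type*} [Fintype V] [DecidableEq V] [Fintype Ω]
    [DecidableEq Ω] (G : SimpleGraph V) [DecidableRel G.Adj] {d K L J s t : ℕ}
    (hG : ∀ v, G.degree v ≤ d) (hK : 0 < K) (hL : 0 < L)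
    (S : V → Finset Ω) (hS : ∀ v, (S v).card = K)
    (hSL : ∀ ω, (Finset.univ.filter fun v => ω ∈ S v).card ≤ L)
    (hSt : ∀ u v, G.Adj u v → t ≤ (S u ∩ S v).card)
    (hs : (Fintype.card V).choose s * (2 ^ J) ^ K < ((2 ^ J) ^ K) ^ s) :
    HasContractionSequence G
      (max (d * (K * L * s)) (2 ^ K * ((K + 1) ^ K * (2 ^ J) ^ (K - t)))) := by
  set w := max (d * (K * L * s)) (2 ^ K * ((K + 1) ^ K * (2 ^ J) ^ (K - t)))
  have he : ∀ v, ∃ e : Fin K → Ω, ∀ ω, ω ∈ S v ↔ ∃ p, e p = ω := by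
    intro v
    let e := (S v).equivFinOfCardEq (hS v)
    refine ⟨fun p => (e.symm p : Ω), fun ω => ⟨fun h => ⟨e ⟨ω, h⟩, by simp⟩, ?_⟩⟩
    rintro ⟨p, rfl⟩
    exact (e.symm p).2
  choose e he using he
  obtain ⟨φ, hφ⟩ := exists_balanced_labelling hK hL (by positivity : 0 < 2 ^ J) S hS hSL e he hs
  -- The label vectors, with the last `i` bits of each label removed.
  let lab : ℕ → V → Fin K → ℕ := fun i v p => (φ (e v p) : ℕ) / 2 ^ i
  have hlab_succ : ∀ i v p, lab (i + 1) v p = lab i v p / 2 := by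
    intro i v p
    simp only [lab, pow_succ, Nat.div_div_eq_div_mul]
  have hlab_lt : ∀ i v p, lab i v p < 2 ^ J := fun i v p =>
    (Nat.div_le_self _ _).trans_lt (φ (e v p)).2
  have hlab_J : ∀ v, lab J v = fun _ => 0 := fun v => funext fun p =>
    Nat.div_eq_of_lt (φ (e v p)).2
  have hshare : ∀ i u v, G.Adj u v →
      ∃ Q : Finset (Fin K), t ≤ Q.card ∧ ∀ q ∈ Q, ∃ p, lab i v q = lab i u p := by
    intro i u v huv
    refine ⟨Finset.univ.filter fun q => e v q ∈ S u, ?_, ?_⟩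
    · refine (hSt u v huv).trans ?_
      refine (Finset.card_le_card fun ω hω => ?_).trans (Finset.card_image_le (f := e v))
      rw [Finset.mem_inter] at hω
      obtain ⟨q, rfl⟩ := (he v ω).1 hω.2
      exact Finset.mem_image_of_mem _ (by simp [hω.1])
    · intro q hq
      obtain ⟨p, hp⟩ := (he u _).1 (Finset.mem_filter.1 hq).2
      exact ⟨p, by simp only [lab, hp]⟩
  -- In partitions finer than that into equal label vectors the parts are small.
  have hbase : ∀ R : Finpartition (Finset.univ : Finset V),
      (∀ x y, R.part x = R.part y → lab 0 x = lab 0 y) → ∀ A ∈ R.parts, redDegree G R A ≤ w := by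
    intro R hR A hA
    obtain ⟨a₀, ha₀⟩ := R.nonempty_of_mem_parts hA
    have hAcard : A.card ≤ K * L * s := by
      refine (Finset.card_le_card fun a ha => ?_).trans (hφ fun p => φ (e a₀ p))
      have h1 := hR a a₀ (by rw [R.part_eq_of_mem hA ha, R.part_eq_of_mem hA ha₀])
      simp only [Finset.mem_filter, Finset.mem_univ, true_and]
      intro p
      have h2 := congrFun h1 p
      simp only [lab, pow_zero, Nat.div_one] at h2
      exact Fin.ext h2
    calc redDegree G R A ≤ (A.biUnion fun a => G.neighborFinset a).card :=
          redDegree_le_card id R (fun x y h => congrArg R.part h) _ fun a ha b hab => by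
            simp only [id, Finset.mem_biUnion, SimpleGraph.mem_neighborFinset]
            exact ⟨a, ha, hab⟩
      _ ≤ A.card * d := Finset.card_biUnion_le_card_mul _ _ _ fun a _ => hG a
      _ ≤ d * (K * L * s) := by rw [mul_comm]; exact Nat.mul_le_mul_left _ hAcard
      _ ≤ w := le_max_left _ _
  -- Between two consecutive truncations a part contains at most `2 ^ K` label vectors.
  have hlevel : ∀ i, ∀ R : Finpartition (Finset.univ : Finset V),
      (∀ x y, lab i x = lab i y → R.part x = R.part y) →
      (∀ x y, R.part x = R.part y → lab (i + 1) x = lab (i + 1) y) →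
      ∀ A ∈ R.parts, redDegree G R A ≤ w := by
    intro i R hR₁ hR₂ A hA
    obtain ⟨a₀, ha₀⟩ := R.nonempty_of_mem_parts hA
    obtain ⟨H, hHcard, hH⟩ := card_halves_le (lab (i + 1) a₀)
    choose T hTcard hT using
      exists_vectors_sharing_labels (K := K) (by positivity : 0 < 2 ^ J) t
    calc redDegree G R A ≤ (H.biUnion T).card := by
          refine redDegree_le_card (lab i) R hR₁ _ fun a ha b hab => ?_
          rw [Finset.mem_biUnion]
          refine ⟨lab i a, hH _ fun q => ?_, hT _ _ (hlab_lt i b) (hshare i a b hab)⟩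
          rw [← hlab_succ, hR₂ a a₀ (by rw [R.part_eq_of_mem hA ha, R.part_eq_of_mem hA ha₀])]
      _ ≤ H.card * ((K + 1) ^ K * (2 ^ J) ^ (K - t)) :=
          Finset.card_biUnion_le_card_mul _ _ _ fun x _ => hTcard x
      _ ≤ 2 ^ K * ((K + 1) ^ K * (2 ^ J) ^ (K - t)) := Nat.mul_le_mul_right _ hHcard
      _ ≤ w := le_max_right _ _
  have hreach : ∀ i, ∃ Q, ReachableWithin G w Q ∧
      ∀ x y, Q.part x = Q.part y ↔ lab i x = lab i y := by
    intro i
    induction i with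
    | zero =>
      have hbot : ∀ x y, (⊥ : Finpartition (Finset.univ : Finset V)).part x =
          (⊥ : Finpartition (Finset.univ : Finset V)).part y → x = y := fun x y h => by
        rwa [Finpartition.part_bot_univ, Finpartition.part_bot_univ, Finset.singleton_inj] at h
      exact (ReachableWithin.bot (hbase ⊥ fun x y h => congrArg _ (hbot x y h))).coarsen (lab 0) ⊥
        (fun x y h => congrArg _ (hbot x y h)) fun R _ hR => hbase R hR
    | succ i ih =>
      obtain ⟨Q, hQ, hker⟩ := ih
      refine hQ.coarsen (lab (i + 1)) Q (fun x y h => ?_) fun R hR₁ hR₂ =>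
        hlevel i R (fun x y h => hR₁ x y ((hker x y).2 h)) hR₂
      have := (hker x y).1 h
      funext p
      rw [hlab_succ, hlab_succ, this]
  obtain ⟨Q, hQ, hker⟩ := hreach J
  exact hQ.hasContractionSequence fun x y => (hker x y).2 (by rw [hlab_J, hlab_J])

/-! ### The upper bound -/

lemma SimpleGraph.isRegularOfDegree_iff_ncard {V : Type*} (G : SimpleGraph V) [G.LocallyFinite]
    (d : ℕ) : G.IsRegularOfDegree d ↔ ∀ v, (G.neighborSet v).ncard = d := by
  refine forall_congr' fun v => ?_
  rw [Set.ncard_eq_toFinset_card', ← SimpleGraph.card_neighborFinset_eq_degree,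
    SimpleGraph.neighborFinset]

lemma div_three_pow_le_factorial (n : ℕ) : ((n : ℝ) / 3) ^ n ≤ n.factorial := by
  have h1 := Real.pow_div_factorial_le_exp (n : ℝ) (Nat.cast_nonneg n) n
  have h2 : Real.exp (n : ℝ) ≤ 3 ^ n := by
    rw [← mul_one (n : ℝ), Real.exp_nat_mul]
    exact pow_le_pow_left₀ (Real.exp_pos 1).le Real.exp_one_lt_three.le n
  rw [div_pow, div_le_iff₀ (by positivity)]
  rw [div_le_iff₀ (by positivity)] at h1
  nlinarith [Nat.cast_nonneg (α := ℝ) n.factorial]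

/-- If `q δ n` is monotone in `δ` and holds for each `δ > 0` and all large `n`, then it holds along
a sequence of values of `δ` that tends to zero. -/
lemma exists_tendsto_zero_of_eventually (q : ℝ → ℕ → Prop)
    (hmono : ∀ n δ δ', 0 ≤ δ → δ ≤ δ' → q δ n → q δ' n) (hex : ∀ n, ∃ δ, 0 ≤ δ ∧ q δ n)
    (hev : ∀ δ, 0 < δ → ∀ᶠ n in atTop, q δ n) :
    ∃ ε : ℕ → ℝ, Tendsto ε atTop (𝓝 0) ∧ ∀ n, 0 ≤ ε n ∧ q (ε n) n := by
  have hpos : ∀ n : ℕ, (0 : ℝ) < 1 / ((n : ℝ) + 1) := fun n => Nat.one_div_pos_of_nat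
  have hbdd : ∀ n, BddBelow {δ | 0 ≤ δ ∧ q δ n} := fun n => ⟨0, fun δ hδ => hδ.1⟩
  have hinf : ∀ n, 0 ≤ sInf {δ | 0 ≤ δ ∧ q δ n} := fun n =>
    Real.sInf_nonneg fun δ hδ => hδ.1
  refine ⟨fun n => sInf {δ | 0 ≤ δ ∧ q δ n} + 1 / ((n : ℝ) + 1), ?_, fun n => ⟨?_, ?_⟩⟩
  · have key : Tendsto (fun n => sInf {δ | 0 ≤ δ ∧ q δ n}) atTop (𝓝 0) := by
      rw [Metric.tendsto_nhds]
      intro δ hδ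
      filter_upwards [hev (δ / 2) (by positivity)] with n hn
      rw [Real.dist_eq, sub_zero, abs_of_nonneg (hinf n)]
      exact (csInf_le (hbdd n) ⟨by positivity, hn⟩).trans_lt (by linarith)
    simpa only [add_zero] using key.add tendsto_one_div_add_atTop_nhds_zero_nat
  · exact add_nonneg (hinf n) (hpos n).le
  · obtain ⟨δ, ⟨hδ0, hδ⟩, hlt⟩ := exists_lt_of_csInf_lt (hex n)
      (lt_add_of_pos_right (sInf {δ | 0 ≤ δ ∧ q δ n}) (hpos n))
    exact hmono n δ _ hδ0 hlt.le hδ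

/-- The condition of the first moment argument holds for `2 ^ k` label vectors if `s` is at least six
times the average number of vertices for a vector, and larger than `k`. -/
lemma choose_mul_lt_pow {n s k : ℕ} (hs : k < s) (hns : (6 : ℝ) * n ≤ 2 ^ k * s) :
    n.choose s * 2 ^ k < (2 ^ k) ^ s := by
  have h1 : (n.choose s : ℝ) ≤ (n : ℝ) ^ s / s.factorial := Nat.choose_le_pow_div s n
  have h2 := div_three_pow_le_factorial s
  have hspos : (0 : ℝ) < s := by exact_mod_cast (Nat.zero_le k).trans_lt hs
  have h3 : (2 : ℝ) ^ s * (n : ℝ) ^ s ≤ (2 ^ k) ^ s * ((s : ℝ) / 3) ^ s := by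
    rw [← mul_pow, ← mul_pow]
    refine pow_le_pow_left₀ (by positivity) ?_ s
    linarith
  have hfac : (0 : ℝ) < s.factorial := by positivity
  have h4 : (2 : ℝ) ^ s * n.choose s ≤ (2 ^ k) ^ s := by
    rw [le_div_iff₀ hfac] at h1
    have h5 : (2 : ℝ) ^ s * n.choose s * s.factorial ≤ (2 ^ k) ^ s * s.factorial := by
      calc (2 : ℝ) ^ s * n.choose s * s.factorial = 2 ^ s * (n.choose s * s.factorial) := by ring
        _ ≤ 2 ^ s * n ^ s := by gcongr
        _ ≤ _ := h3
        _ ≤ _ := by gcongr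
    exact le_of_mul_le_mul_right h5 hfac
  have h6 : 2 ^ s * n.choose s ≤ (2 ^ k) ^ s := by exact_mod_cast h4
  have h7 : 2 ^ k < 2 ^ s := Nat.pow_lt_pow_right (by norm_num) hs
  rcases Nat.eq_zero_or_pos (n.choose s) with h0 | h0
  · rw [h0, zero_mul]; positivity
  · calc n.choose s * 2 ^ k < n.choose s * 2 ^ s := Nat.mul_lt_mul_of_pos_left h7 h0
      _ ≤ _ := by rw [mul_comm]; exact h6

/-- The twin-width of a regular graph in terms of the number `D` of copies of the covering, the
number `J` of bits of the labels, and the size parameter `s` of the fibres. -/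
lemma twinWidth_le_of_regular {V : Type*} [Fintype V] [DecidableEq V] (G : SimpleGraph V)
    [DecidableRel G.Adj] {d : ℕ} (hd : 2 ≤ d) (hG : G.IsRegularOfDegree d) {D J s : ℕ}
    (hD : 0 < D) (hs : J * (D * d) < s)
    (hns : (6 : ℝ) * Fintype.card V ≤ 2 ^ (J * (D * d)) * s) :
    twinWidth G ≤ max (d * (D * d * (2 * D) * s))
      (2 ^ (D * d) * ((D * d + 1) ^ (D * d) * (2 ^ J) ^ (D * d - 2 * (D - 2)))) := by
  obtain ⟨S, hS, hSt, hSL⟩ := exists_cover_sets G hd hG hD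
  refine (hasContractionSequence_of_cover G (fun v => (hG v).le) (by positivity) (by positivity)
    S hS hSL hSt ?_).twinWidth_le
  rw [← pow_mul]
  exact choose_mul_lt_pow hs hns

lemma exists_forall_twinWidth_le_mul_rpow {d : ℕ} (hd : 2 ≤ d) {δ : ℝ} (hδ : 0 < δ) :
    ∃ C : ℝ, 0 < C ∧ ∀ (V : Type*) [Fintype V] [DecidableEq V] (G : SimpleGraph V)
      [DecidableRel G.Adj], G.IsRegularOfDegree d → 1 ≤ Fintype.card V →
        (twinWidth G : ℝ) ≤
          C * (Fintype.card V : ℝ) ^ (((d : ℝ) - 2) / (2 * d - 2) + δ) := by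
  obtain ⟨D, hDδ⟩ := exists_nat_gt (max 2 (4 / δ))
  have hD2 : 2 < D := by exact_mod_cast (le_max_left _ _).trans_lt hDδ
  have hD4 : 4 / δ < D := (le_max_right _ _).trans_lt hDδ
  have hd' : (2 : ℝ) ≤ d := by exact_mod_cast hd
  set γ : ℝ := ((d : ℝ) - 2) / (2 * d - 2) with hγ
  set K : ℕ := D * d with hK
  have hKpos : 0 < K := by positivity
  have hKR : (0 : ℝ) < K := by exact_mod_cast hKpos
  have hγ0 : 0 ≤ γ := div_nonneg (by linarith) (by linarith)
  have hγ1 : γ ≤ 1 := (div_le_one (by linarith)).2 (by linarith)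
  set C₁ : ℝ := d * (K * (2 * D)) * (6 * 2 ^ K + 2 + 2 / δ)
  set C₂ : ℝ := 2 ^ K * (K + 1) ^ K
  refine ⟨C₁ + C₂, by positivity, ?_⟩
  intro V _ _ G _ hG hn
  set n := Fintype.card V
  have hn' : (1 : ℝ) ≤ n := by exact_mod_cast hn
  have hn0 : (0 : ℝ) < n := by linarith
  -- The number of label vectors is of the order of `n ^ (1 - γ)`. The term `J * K` of `s` below
  -- compensates for the union bound over the vectors.
  set x : ℝ := (n : ℝ) ^ ((1 - γ) / K) with hx
  have hx1 : 1 ≤ x := Real.one_le_rpow hn' (div_nonneg (by linarith) hKR.le)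
  set J := Nat.log 2 ⌊x⌋₊
  have hfl : ⌊x⌋₊ ≠ 0 := (Nat.floor_pos.2 hx1).ne'
  have hJ1 : (2 : ℝ) ^ J ≤ x := by
    have : 2 ^ J ≤ ⌊x⌋₊ := Nat.pow_log_le_self 2 hfl
    calc (2 : ℝ) ^ J = ((2 ^ J : ℕ) : ℝ) := by push_cast; rfl
      _ ≤ ⌊x⌋₊ := by exact_mod_cast this
      _ ≤ x := Nat.floor_le (by linarith)
  have hJ2 : x ≤ 2 * 2 ^ J := by
    have : ⌊x⌋₊ < 2 ^ (J + 1) := Nat.lt_pow_succ_log_self (by norm_num) _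
    have h2 : x < ((2 ^ (J + 1) : ℕ) : ℝ) := (Nat.floor_lt (by linarith)).1 this
    push_cast at h2
    rw [pow_succ] at h2
    linarith
  have hxK : x ^ K = (n : ℝ) ^ (1 - γ) := by
    rw [hx, ← Real.rpow_natCast, ← Real.rpow_mul hn0.le, div_mul_cancel₀ _ hKR.ne']
  have hN2 : (n : ℝ) ^ (1 - γ) ≤ 2 ^ K * 2 ^ (J * K) := by
    rw [← hxK, pow_mul 2 J K, ← mul_pow]
    exact pow_le_pow_left₀ (by linarith) hJ2 K
  have hN1 : (2 : ℝ) ^ (J * K) ≤ n := by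
    rw [pow_mul]
    calc ((2 : ℝ) ^ J) ^ K ≤ x ^ K := pow_le_pow_left₀ (by positivity) hJ1 K
      _ = (n : ℝ) ^ (1 - γ) := hxK
      _ ≤ (n : ℝ) ^ (1 : ℝ) := Real.rpow_le_rpow_of_exponent_le hn' (by linarith)
      _ = n := Real.rpow_one _
  set s : ℕ := ⌈6 * 2 ^ K * (n : ℝ) ^ γ⌉₊ + J * K with hs
  have hceil : 6 * 2 ^ K * (n : ℝ) ^ γ ≤ ⌈6 * 2 ^ K * (n : ℝ) ^ γ⌉₊ := Nat.le_ceil _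
  have hs1 : J * K < s := by
    have : 0 < ⌈6 * 2 ^ K * (n : ℝ) ^ γ⌉₊ := Nat.ceil_pos.2 (by positivity)
    omega
  have hns : (6 : ℝ) * n ≤ 2 ^ (J * K) * s := by
    have h1 : (6 * 2 ^ K * (n : ℝ) ^ γ) ≤ s := by
      rw [hs]; push_cast
      have : (0 : ℝ) ≤ J * K := by positivity
      linarith
    have h2 : (n : ℝ) = (n : ℝ) ^ (1 - γ) * (n : ℝ) ^ γ := by
      rw [← Real.rpow_add hn0, sub_add_cancel, Real.rpow_one]
    calc (6 : ℝ) * n = 6 * ((n : ℝ) ^ (1 - γ) * (n : ℝ) ^ γ) := by rw [← h2]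
      _ ≤ 6 * ((2 ^ K * 2 ^ (J * K)) * (n : ℝ) ^ γ) := by gcongr
      _ = 2 ^ (J * K) * (6 * 2 ^ K * (n : ℝ) ^ γ) := by ring
      _ ≤ _ := by gcongr
  have hmono : ∀ a, a ≤ γ + δ → (n : ℝ) ^ a ≤ (n : ℝ) ^ (γ + δ) := fun a ha =>
    Real.rpow_le_rpow_of_exponent_le hn' ha
  have hone : 1 ≤ (n : ℝ) ^ (γ + δ) := Real.one_le_rpow hn' (by linarith)
  have hJK : ((J * K : ℕ) : ℝ) ≤ 2 / δ * (n : ℝ) ^ (γ + δ) := by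
    have h1 : ((J * K : ℕ) : ℝ) * Real.log 2 ≤ Real.log n := by
      rw [← Real.log_pow]
      exact Real.log_le_log (by positivity) hN1
    have h2 := Real.log_le_rpow_div hn0.le hδ
    have h3 := hmono δ (by linarith)
    have h4 := Real.log_two_gt_d9
    have h5 : ((J * K : ℕ) : ℝ) * (1 / 2) ≤ (n : ℝ) ^ (γ + δ) / δ := by
      calc ((J * K : ℕ) : ℝ) * (1 / 2) ≤ ((J * K : ℕ) : ℝ) * Real.log 2 := by
            gcongr; linarith
        _ ≤ (n : ℝ) ^ δ / δ := h1.trans h2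
        _ ≤ _ := by gcongr
    calc ((J * K : ℕ) : ℝ) = 2 * (((J * K : ℕ) : ℝ) * (1 / 2)) := by ring
      _ ≤ 2 * ((n : ℝ) ^ (γ + δ) / δ) := by gcongr
      _ = _ := by ring
  have hsle : (s : ℝ) ≤ (6 * 2 ^ K + 2 + 2 / δ) * (n : ℝ) ^ (γ + δ) := by
    have h1 : (⌈6 * 2 ^ K * (n : ℝ) ^ γ⌉₊ : ℝ) < 6 * 2 ^ K * (n : ℝ) ^ γ + 1 :=
      Nat.ceil_lt_add_one (by positivity)
    have h2 : 6 * 2 ^ K * (n : ℝ) ^ γ ≤ 6 * 2 ^ K * (n : ℝ) ^ (γ + δ) := by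
      have := hmono γ (by linarith)
      gcongr
    rw [hs, Nat.cast_add]
    linarith
  have hfirst : ((d * (K * (2 * D) * s) : ℕ) : ℝ) ≤ C₁ * (n : ℝ) ^ (γ + δ) := by
    push_cast
    calc (d : ℝ) * (K * (2 * D) * s) = d * (K * (2 * D)) * s := by ring
      _ ≤ d * (K * (2 * D)) * ((6 * 2 ^ K + 2 + 2 / δ) * (n : ℝ) ^ (γ + δ)) := by gcongr
      _ = _ := by ring
  have hsecond : ((2 ^ K * ((K + 1) ^ K * (2 ^ J) ^ (K - 2 * (D - 2))) : ℕ) : ℝ) ≤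
      C₂ * (n : ℝ) ^ (γ + δ) := by
    push_cast
    have hle : 2 * (D - 2) ≤ K := by
      calc 2 * (D - 2) ≤ 2 * D := by omega
        _ ≤ K := by rw [hK, mul_comm]; exact Nat.mul_le_mul_left _ hd
    have hexp : (1 - γ) / K * ((K - 2 * (D - 2) : ℕ) : ℝ) ≤ γ + δ := by
      have hDR : (0 : ℝ) < D := by exact_mod_cast (by omega : 0 < D)
      have h1 : ((K - 2 * (D - 2) : ℕ) : ℝ) = (D : ℝ) * (d - 2) + 4 := by
        rw [Nat.cast_sub hle, Nat.cast_mul, Nat.cast_mul, Nat.cast_sub hD2.le]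
        push_cast; ring
      have h2 : 1 - γ = d / (2 * d - 2) := by
        rw [hγ, eq_div_iff (by linarith : (2 * (d : ℝ) - 2) ≠ 0), sub_mul,
          div_mul_cancel₀ _ (by linarith : (2 * (d : ℝ) - 2) ≠ 0)]
        ring
      have h3 : (1 - γ) / K * ((D : ℝ) * (d - 2) + 4) = γ + 4 / D / (2 * d - 2) := by
        have h4 : (2 * (d : ℝ) - 2) ≠ 0 := by linarith
        rw [h2, hγ, hK]
        push_cast
        field_simp
      rw [h1, h3]
      have h5 : 4 / (D : ℝ) / (2 * d - 2) ≤ 4 / D := by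
        apply div_le_self (by positivity)
        linarith
      have h6 : 4 / (D : ℝ) ≤ δ := by
        rw [div_le_iff₀ hDR]
        rw [div_lt_iff₀ hδ] at hD4
        linarith
      linarith
    calc (2 : ℝ) ^ K * ((K + 1) ^ K * (2 ^ J) ^ (K - 2 * (D - 2)))
        ≤ 2 ^ K * ((K + 1) ^ K * x ^ (K - 2 * (D - 2))) := by gcongr
      _ = C₂ * (n : ℝ) ^ ((1 - γ) / K * ((K - 2 * (D - 2) : ℕ) : ℝ)) := by
          rw [hx, ← Real.rpow_natCast ((n : ℝ) ^ _), ← Real.rpow_mul hn0.le]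
          ring
      _ ≤ _ := by
          have := hmono _ hexp
          gcongr
  have hmain := twinWidth_le_of_regular G hd hG (by omega) hs1 hns
  have hCpos : 0 ≤ C₁ * (n : ℝ) ^ (γ + δ) ∧ 0 ≤ C₂ * (n : ℝ) ^ (γ + δ) :=
    ⟨by positivity, by positivity⟩
  calc (twinWidth G : ℝ) ≤ ((max (d * (K * (2 * D) * s))
        (2 ^ K * ((K + 1) ^ K * (2 ^ J) ^ (K - 2 * (D - 2)))) : ℕ) : ℝ) := by
        exact_mod_cast hmain
    _ ≤ (C₁ + C₂) * (n : ℝ) ^ (γ + δ) := by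
        rw [Nat.cast_max, add_mul]
        exact max_le (by linarith) (by linarith)

/-- Every `d`-regular graph on `n` vertices has twin-width at most `n ^ (γ + o(1))`, where
`γ = (d - 2) / (2 * d - 2)`. -/
theorem exists_forall_twinWidth_le_rpow {d : ℕ} (hd : 2 ≤ d) :
    ∃ ε : ℕ → ℝ, Tendsto ε atTop (𝓝 0) ∧
      ∀ (V : Type*) [Fintype V] [DecidableEq V] (G : SimpleGraph V) [G.LocallyFinite],
        G.IsRegularOfDegree d →
          (twinWidth G : ℝ) ≤
            (Fintype.card V : ℝ) ^ (((d : ℝ) - 2) / (2 * d - 2) + ε (Fintype.card V)) := by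
  have hd' : (2 : ℝ) ≤ d := by exact_mod_cast hd
  set γ : ℝ := ((d : ℝ) - 2) / (2 * d - 2) with hγ
  have hγ0 : 0 ≤ γ := div_nonneg (by linarith) (by linarith)
  refine Exists.imp (fun ε hq => ⟨hq.1, fun V _ _ G _ hG => (hq.2 _).2 V G hG rfl⟩)
    (exists_tendsto_zero_of_eventually
      (fun δ n => ∀ (V : Type _) [Fintype V] [DecidableEq V] (G : SimpleGraph V)
        [G.LocallyFinite], G.IsRegularOfDegree d → Fintype.card V = n →
          (twinWidth G : ℝ) ≤ (n : ℝ) ^ (γ + δ)) ?_ ?_ ?_)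
  · intro n δ δ' _ hδ h V _ _ G _ hG hV
    rcases Nat.eq_zero_or_pos n with rfl | hn
    · have : twinWidth G = 0 := Nat.le_zero.1 (hV ▸ twinWidth_le_card G)
      rw [this, Nat.cast_zero]
      exact Real.rpow_nonneg (by simp) _
    · refine (h V G hG hV).trans (Real.rpow_le_rpow_of_exponent_le ?_ (by linarith))
      exact_mod_cast hn
  · intro n
    refine ⟨1, zero_le_one, fun V _ _ G _ hG hV => ?_⟩
    have h1 : twinWidth G ≤ n := hV ▸ twinWidth_le_card G
    rcases Nat.eq_zero_or_pos n with rfl | hn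
    · rw [Nat.le_zero.1 h1, Nat.cast_zero]
      exact Real.rpow_nonneg (by simp) _
    · calc (twinWidth G : ℝ) ≤ (n : ℝ) ^ (1 : ℝ) := by rw [Real.rpow_one]; exact_mod_cast h1
        _ ≤ _ := Real.rpow_le_rpow_of_exponent_le (by exact_mod_cast hn) (by linarith)
  · intro δ hδ
    obtain ⟨C, hC, hCle⟩ := exists_forall_twinWidth_le_mul_rpow hd (half_pos hδ)
    have htend : Tendsto (fun n : ℕ => (n : ℝ) ^ (δ / 2)) atTop atTop :=
      (tendsto_rpow_atTop (half_pos hδ)).comp tendsto_natCast_atTop_atTop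
    filter_upwards [htend.eventually_ge_atTop C, eventually_ge_atTop 1] with n hnC hn
    intro V _ _ G _ hG hV
    classical
    have hn0 : (0 : ℝ) < n := by exact_mod_cast hn
    have h1 := hCle V G (by
      rw [SimpleGraph.isRegularOfDegree_iff_ncard] at hG ⊢
      exact hG) (by omega)
    rw [hV] at h1
    calc (twinWidth G : ℝ) ≤ C * (n : ℝ) ^ (γ + δ / 2) := h1
      _ ≤ (n : ℝ) ^ (δ / 2) * (n : ℝ) ^ (γ + δ / 2) := by gcongr
      _ = (n : ℝ) ^ (γ + δ) := by
          rw [← Real.rpow_add hn0]; congr 1; ring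

/-! ### Pieces of equal size from a contraction sequence -/

section Pieces

variable {V : Type*} [Fintype V] [DecidableEq V]

/-- Bookkeeping for a partition `P` in a contraction sequence of width `w`. The function `g` labels
the vertices by pieces. The labels in `L` are those of the completed pieces, which have at least
`s` elements; the vertices outside of them that lie in a common part of `P` form a single piece,
which is still smaller than `s`. Each edge at a completed piece stays inside this piece or
joins a pair of pieces in `E`, where `E` has at most `w` pairs for each completed piece. -/
structure IsPieceLabelling (G : SimpleGraph V) (w s : ℕ)
    (P : Finpartition (Finset.univ : Finset V)) (g : V → V) (L : Finset V)
    (E : Finset (V × V)) : Prop where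
  card_fibre_lt : ∀ a, (Finset.univ.filter fun x => g x = a).card < 2 * s
  le_card_fibre : ∀ a ∈ L, s ≤ (Finset.univ.filter fun x => g x = a).card
  card_open_lt : ∀ a ∉ L, (Finset.univ.filter fun x => g x = a).card < s
  part_iff : ∀ x y, g x ∉ L → g y ∉ L → (g x = g y ↔ P.part x = P.part y)
  cover : ∀ x y, G.Adj x y → g x ∈ L → g x = g y ∨ (g x, g y) ∈ E ∨ (g y, g x) ∈ E
  card_le : E.card ≤ w * L.card

/-- If a single piece has become too large, it is declared complete. Its edges to the vertices
outside of the completed pieces go to at most `w` parts, since a part with at least `s` elements is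
fully adjacent to no vertex. -/
lemma IsPieceLabelling.of_complete {G : SimpleGraph V} {w s : ℕ}
    {P : Finpartition (Finset.univ : Finset V)} {g : V → V} {L : Finset V} {E : Finset (V × V)}
    (hdeg : ∀ y (T : Finset V), (∀ x ∈ T, G.Adj x y) → T.card < s)
    (hred : ∀ A ∈ P.parts, redDegree G P A ≤ w) (α : V)
    (h1 : ∀ a, (Finset.univ.filter fun x => g x = a).card < 2 * s)
    (h2 : ∀ a ∈ L, s ≤ (Finset.univ.filter fun x => g x = a).card)
    (h3 : ∀ a ∉ L, a ≠ α → (Finset.univ.filter fun x => g x = a).card < s)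
    (h4 : ∀ x y, g x ∉ L → g y ∉ L → (g x = g y ↔ P.part x = P.part y))
    (h5 : ∀ x y, G.Adj x y → g x ∈ L → g x = g y ∨ (g x, g y) ∈ E ∨ (g y, g x) ∈ E)
    (h6 : E.card ≤ w * L.card) :
    ∃ L' E', IsPieceLabelling G w s P g L' E' := by
  classical
  by_cases hα : α ∉ L ∧ s ≤ (Finset.univ.filter fun x => g x = α).card
  swap
  · refine ⟨L, E, h1, h2, fun a ha => ?_, h4, h5, h6⟩
    by_cases hne : a = α
    · subst hne
      by_contra! hlt
      exact hα ⟨ha, hlt⟩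
    · exact h3 a ha hne
  obtain ⟨hαL, hαs⟩ := hα
  -- The new pairs: from `α` to the open pieces adjacent to it.
  let N : Finset (V × V) := (Finset.univ.filter fun y => g y ∉ L ∧ g y ≠ α ∧
    ∃ x, g x = α ∧ G.Adj x y).image fun y => (α, g y)
  have hN : N.card ≤ w := by
    rcases (Finset.univ.filter fun y => g y ∉ L ∧ g y ≠ α ∧
      ∃ x, g x = α ∧ G.Adj x y).eq_empty_or_nonempty with he | ⟨y₀, hy₀⟩
    · simp [N, he]
    obtain ⟨-, -, x₀, hx₀, -⟩ := (Finset.mem_filter.1 hy₀).2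
    refine le_trans ?_ (hred _ (P.part_univ_mem x₀))
    let f : Finset V → V × V := fun B =>
      if h : ∃ y ∈ B, g y ∉ L then (α, g h.choose) else (α, α)
    have hsub : (N : Set (V × V)) ⊆ f '' {B | B ∈ P.parts ∧ RedAdj G (P.part x₀) B} := by
      intro p hp
      obtain ⟨y, hy, rfl⟩ := Finset.mem_image.1 (Finset.mem_coe.1 hp)
      obtain ⟨hyL, hyα, x, hx, hxy⟩ := (Finset.mem_filter.1 hy).2
      have hmem : ∀ z, g z = α → z ∈ P.part x₀ := fun z hz => by
        have : P.part z = P.part x₀ := (h4 z x₀ (hz ▸ hαL) (hx₀ ▸ hαL)).1 (hz.trans hx₀.symm)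
        rw [← this]
        exact P.self_mem_part_univ z
      refine ⟨P.part y, ⟨P.part_univ_mem y, ?_, ?_, ?_⟩, ?_⟩
      · intro h
        exact hyα (((h4 x₀ y (hx₀ ▸ hαL) hyL).2 h).symm.trans hx₀)
      · intro h
        have := hdeg y (Finset.univ.filter fun x => g x = α) fun z hz =>
          h z (hmem z (Finset.mem_filter.1 hz).2) y (P.self_mem_part_univ y)
        omega
      · intro h
        exact h x (hmem x hx) y (P.self_mem_part_univ y) hxy
      · have h : ∃ z ∈ P.part y, g z ∉ L := ⟨y, P.self_mem_part_univ y, hyL⟩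
        simp only [f, h, dite_true]
        rw [(h4 _ y h.choose_spec.2 hyL).2
          (P.part_eq_of_mem (P.part_univ_mem y) h.choose_spec.1)]
    have hfin : {B | B ∈ P.parts ∧ RedAdj G (P.part x₀) B}.Finite := Set.toFinite _
    calc N.card = (N : Set (V × V)).ncard := (Set.ncard_coe_finset N).symm
      _ ≤ _ := Set.ncard_le_ncard hsub (hfin.image f)
      _ ≤ _ := Set.ncard_image_le hfin
  refine ⟨insert α L, E ∪ N, h1, ?_, ?_, ?_, ?_, ?_⟩
  · intro a ha
    rcases Finset.mem_insert.1 ha with rfl | ha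
    · exact hαs
    · exact h2 a ha
  · intro a ha
    rw [Finset.mem_insert, not_or] at ha
    exact h3 a ha.2 ha.1
  · intro x y hx hy
    rw [Finset.mem_insert, not_or] at hx hy
    exact h4 x y hx.2 hy.2
  · intro x y hxy hx
    rw [Finset.mem_union, Finset.mem_union]
    by_cases hxL : g x ∈ L
    · rcases h5 x y hxy hxL with h | h | h <;> simp [h]
    by_cases hyL : g y ∈ L
    · rcases h5 y x hxy.symm hyL with h | h | h <;> simp [h]
    have hxα : g x = α := (Finset.mem_insert.1 hx).resolve_right hxL
    by_cases hyα : g y = α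
    · exact Or.inl (hxα.trans hyα.symm)
    · right; left; right
      rw [hxα]
      exact Finset.mem_image.2 ⟨y, Finset.mem_filter.2
        ⟨Finset.mem_univ y, hyL, hyα, x, hxα, hxy⟩, rfl⟩
  · rw [Finset.card_insert_of_notMem hαL, Nat.mul_succ]
    exact (Finset.card_union_le _ _).trans (add_le_add h6 hN)

lemma part_eq_part_iff_of_isMerge {P Q : Finpartition (Finset.univ : Finset V)} {A B : Finset V}
    (hA : A ∈ P.parts) (hB : B ∈ P.parts)
    (hQ : Q.parts = insert (A ∪ B) ((P.parts.erase A).erase B)) (x y : V) :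
    Q.part x = Q.part y ↔ P.part x = P.part y ∨
      ((P.part x = A ∨ P.part x = B) ∧ (P.part y = A ∨ P.part y = B)) := by
  have hmem : ∀ z, z ∈ A ∪ B → P.part z = A ∨ P.part z = B := by
    intro z hz
    rcases Finset.mem_union.1 hz with hz | hz
    · exact Or.inl (P.part_eq_of_mem hA hz)
    · exact Or.inr (P.part_eq_of_mem hB hz)
  rw [part_of_isMerge hQ x, part_of_isMerge hQ y]
  split_ifs with hx hy hy
  · simp [hx, hy]
  · simp only [hx, hy, and_false, or_false]
    constructor
    · intro h
      exact absurd (hmem y (h ▸ P.self_mem_part_univ y)) hy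
    · intro h
      exact absurd (h ▸ hx) hy
  · simp only [hx, hy, false_and, or_false]
    constructor
    · intro h
      exact absurd (hmem x (h ▸ P.self_mem_part_univ x)) hx
    · intro h
      exact absurd (h ▸ hy) hx
  · simp [hx]

lemma IsPieceLabelling.step {G : SimpleGraph V} {w s : ℕ}
    {P Q : Finpartition (Finset.univ : Finset V)} {g : V → V} {L : Finset V} {E : Finset (V × V)}
    (hdeg : ∀ y (T : Finset V), (∀ x ∈ T, G.Adj x y) → T.card < s)
    (h : IsPieceLabelling G w s P g L E) (hPQ : IsMerge P Q)
    (hred : ∀ A ∈ Q.parts, redDegree G Q A ≤ w) :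
    ∃ g' L' E', IsPieceLabelling G w s Q g' L' E' := by
  obtain ⟨A, hA, B, hB, hAB, hQ⟩ := hPQ
  have hiff := part_eq_part_iff_of_isMerge hA hB hQ
  by_cases hopen : (∃ a, P.part a = A ∧ g a ∉ L) ∧ ∃ b, P.part b = B ∧ g b ∉ L
  · -- Both parts have an open piece: these two pieces are united.
    obtain ⟨⟨a, ha, haL⟩, b, hb, hbL⟩ := hopen
    have hgA : ∀ x, g x ∉ L → (P.part x = A ↔ g x = g a) := fun x hx => by
      rw [h.part_iff x a hx haL, ha]
    have hgB : ∀ x, g x ∉ L → (P.part x = B ↔ g x = g b) := fun x hx => by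
      rw [h.part_iff x b hx hbL, hb]
    have hab : g a ≠ g b := fun hab => hAB (by rw [← ha, ← hb, (h.part_iff a b haL hbL).1 hab])
    let π : V → V := fun l => if l = g b then g a else l
    have hπL : ∀ l, π l ∈ L ↔ l ∈ L := by
      intro l
      by_cases hl : l = g b
      · simp [π, hl, haL, hbL]
      · simp [π, hl]
    have hπ_of_mem : ∀ l ∈ L, π l = l := by
      intro l hl
      have : l ≠ g b := fun h => hbL (h ▸ hl)
      simp [π, this]
    have hfib : ∀ l, l ≠ g a → (Finset.univ.filter fun x => π (g x) = l).card ≤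
        (Finset.univ.filter fun x => g x = l).card := by
      intro l hl
      refine Finset.card_le_card fun x hx => ?_
      simp only [π, Finset.mem_filter, Finset.mem_univ, true_and] at hx ⊢
      split_ifs at hx with hx'
      · exact absurd hx.symm hl
      · exact hx
    refine ⟨fun x => π (g x), IsPieceLabelling.of_complete (L := L)
      (E := E.image fun p => (π p.1, π p.2)) hdeg hred (g a) ?_ ?_ ?_ ?_ ?_ ?_⟩
    · intro l
      by_cases hl : l = g a
      · subst hl
        calc (Finset.univ.filter fun x => π (g x) = g a).card
            ≤ ((Finset.univ.filter fun x => g x = g a) ∪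
              (Finset.univ.filter fun x => g x = g b)).card := by
              refine Finset.card_le_card fun x hx => ?_
              simp only [π, Finset.mem_filter, Finset.mem_univ, true_and, Finset.mem_union] at hx ⊢
              split_ifs at hx with hx'
              · exact Or.inr hx'
              · exact Or.inl hx
          _ ≤ _ := Finset.card_union_le _ _
          _ < 2 * s := by
              have h1 := h.card_open_lt _ haL
              have h2 := h.card_open_lt _ hbL
              omega
      · exact (hfib l hl).trans_lt (h.card_fibre_lt l)
    · intro l hl
      refine (h.le_card_fibre l hl).trans (Finset.card_le_card fun x hx => ?_)
      simp only [Finset.mem_filter, Finset.mem_univ, true_and] at hx ⊢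
      rw [hx, hπ_of_mem l hl]
    · intro l hl hla
      exact (hfib l hla).trans_lt (h.card_open_lt l hl)
    · intro x y hx hy
      rw [hπL] at hx hy
      rw [hiff, hgA x hx, hgB x hx, hgA y hy, hgB y hy, ← h.part_iff x y hx hy]
      simp only [π]
      split_ifs with h1 h2 h2
      · simp [h1, h2]
      · simp only [h1, h2, or_true, true_and, or_false]
        constructor
        · intro h3; exact Or.inr h3.symm
        · rintro (h3 | h3)
          · exact absurd h3.symm h2
          · exact h3.symm
      · simp only [h1, h2, or_true, and_true, or_false, false_or]
      · simp only [h1, h2, or_false]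
        constructor
        · exact Or.inl
        · rintro (h3 | ⟨h3, h4⟩)
          · exact h3
          · rw [h3, h4]
    · intro x y hxy hx
      rw [hπL] at hx
      rcases h.cover x y hxy hx with h1 | h1 | h1
      · exact Or.inl (congrArg π h1)
      · exact Or.inr (Or.inl (Finset.mem_image_of_mem (fun p : V × V => (π p.1, π p.2)) h1))
      · exact Or.inr (Or.inr (Finset.mem_image_of_mem (fun p : V × V => (π p.1, π p.2)) h1))
    · exact Finset.card_image_le.trans h.card_le
  · -- One of the two parts consists of completed pieces, and the open pieces do not change.
    rcases isEmpty_or_nonempty V with hV | ⟨⟨v⟩⟩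
    · exact (P.nonempty_of_mem_parts hA).elim fun x _ => hV.elim x
    obtain ⟨L', E', hL'⟩ := IsPieceLabelling.of_complete (g := g) hdeg hred v h.card_fibre_lt
      h.le_card_fibre (fun a ha _ => h.card_open_lt a ha) (fun x y hx hy => by
        rw [hiff, h.part_iff x y hx hy]
        constructor
        · exact Or.inl
        · rintro (h1 | ⟨h1 | h1, h2 | h2⟩)
          · exact h1
          · rw [h1, h2]
          · exact absurd ⟨⟨x, h1, hx⟩, y, h2, hy⟩ hopen
          · exact absurd ⟨⟨y, h2, hy⟩, x, h1, hx⟩ hopen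
          · rw [h1, h2]) h.cover h.card_le
    exact ⟨g, L', E', hL'⟩

/-- A graph of small maximum degree with a contraction sequence of width `w` can be divided into
about `n / s` pieces of fewer than `2 * s` vertices such that all edges between different pieces
run between at most `w * n / s` pairs of pieces. -/
theorem HasContractionSequence.exists_pieces {G : SimpleGraph V} {w s : ℕ} (hs : 2 ≤ s)
    (hdeg : ∀ y (T : Finset V), (∀ x ∈ T, G.Adj x y) → T.card < s)
    (h : HasContractionSequence G w) :
    ∃ (g : V → V) (E : Finset (V × V)),
      (∀ a, (Finset.univ.filter fun x => g x = a).card < 2 * s) ∧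
      (Finset.univ.image g).card * s ≤ Fintype.card V + s ∧
      E.card * s ≤ w * Fintype.card V ∧
      ∀ x y, G.Adj x y → g x = g y ∨ (g x, g y) ∈ E ∨ (g y, g x) ∈ E := by
  obtain ⟨k, P, h0, hk, hmerge, hred⟩ := h
  have key : ∀ i ≤ k, ∃ g L E, IsPieceLabelling G w s (P i) g L E := by
    intro i
    induction i with
    | zero =>
      intro _
      have hone : ∀ a : V, (Finset.univ.filter fun x => id x = a).card < s := fun a =>
        (Finset.card_le_one.2 (by simp)).trans_lt (by omega)
      refine ⟨id, ∅, ∅, fun a => (hone a).trans (by omega), by simp, fun a _ => hone a, ?_,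
        by simp, by simp⟩
      intro x y _ _
      rw [h0, Finpartition.part_bot_univ, Finpartition.part_bot_univ, Finset.singleton_inj]
      rfl
    | succ i ih =>
      intro hi
      obtain ⟨g, L, E, hg⟩ := ih (by omega)
      exact hg.step hdeg (hmerge i hi) (hred (i + 1) hi)
  obtain ⟨g, L, E, hg⟩ := key k le_rfl
  have hLs : L.card * s ≤ Fintype.card V := by
    rw [← Finset.card_univ (α := V), ← smul_eq_mul]
    calc L.card • s ≤ ∑ a ∈ L, (Finset.univ.filter fun x => g x = a).card :=
          Finset.card_nsmul_le_sum _ _ _ hg.le_card_fibre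
      _ = (L.biUnion fun a => Finset.univ.filter fun x => g x = a).card := by
          rw [Finset.card_biUnion]
          intro a _ b _ hab
          rw [Function.onFun, Finset.disjoint_filter]
          rintro x - rfl
          exact hab
      _ ≤ _ := Finset.card_le_card (Finset.subset_univ _)
  have hpart : ∀ x y, g x ∉ L → g y ∉ L → g x = g y := fun x y hx hy =>
    (hg.part_iff x y hx hy).2
      (Finset.card_le_one.1 hk _ ((P k).part_univ_mem x) _ ((P k).part_univ_mem y))
  refine ⟨g, E, hg.card_fibre_lt, ?_, ?_, ?_⟩
  · have himg : (Finset.univ.image g).card ≤ L.card + 1 := by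
      have h1 : Finset.univ.image g ⊆ L ∪ (Finset.univ.image g).filter (· ∉ L) := by
        intro a ha
        by_cases haL : a ∈ L <;> simp [haL] at ha ⊢
        exact ha
      refine (Finset.card_le_card h1).trans ((Finset.card_union_le _ _).trans ?_)
      refine Nat.add_le_add_left (Finset.card_le_one.2 ?_) _
      intro a ha b hb
      simp only [Finset.mem_filter, Finset.mem_image, Finset.mem_univ, true_and] at ha hb
      obtain ⟨⟨x, rfl⟩, hx⟩ := ha
      obtain ⟨⟨y, rfl⟩, hy⟩ := hb
      exact hpart x y hx hy
    calc (Finset.univ.image g).card * s ≤ (L.card + 1) * s := Nat.mul_le_mul_right _ himg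
      _ = L.card * s + s := by ring
      _ ≤ _ := by omega
  · calc E.card * s ≤ w * L.card * s := Nat.mul_le_mul_right _ hg.card_le
      _ = w * (L.card * s) := by ring
      _ ≤ _ := Nat.mul_le_mul_left _ hLs
  · intro x y hxy
    by_cases hx : g x ∈ L
    · exact hg.cover x y hxy hx
    by_cases hy : g y ∈ L
    · rcases hg.cover y x hxy.symm hy with h1 | h1 | h1 <;> simp [h1]
    · exact Or.inl (hpart x y hx hy)

end Pieces

/-! ### Counting graphs that are divided into pieces -/

section Counting

variable {V : Type*} [Fintype V] [DecidableEq V]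

/-- The idempotent self-maps with at most `hi` values all of whose fibres are smaller than `b`.
They encode partitions, each part being labelled by one of its elements. -/
def boundedRetractions (V : Type*) [Fintype V] [DecidableEq V] (hi b : ℕ) : Finset (V → V) :=
  Finset.univ.filter fun r => (∀ x, r (r x) = r x) ∧ (Finset.univ.image r).card ≤ hi ∧
    ∀ a, (Finset.univ.filter fun x => r x = a).card < b

/-- A map in `boundedRetractions V hi b` has at least `|V| / b` values, which are fixed points, so
that only the values at the other points remain to be chosen. -/
lemma card_boundedRetractions_le {hi b : ℕ} (hhi : 0 < hi) :
    (boundedRetractions V hi b).card ≤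
      2 ^ Fintype.card V * hi ^ (Fintype.card V - Fintype.card V / b) := by
  set n := Fintype.card V
  let 𝓘 : Finset (Finset V) :=
    (Finset.univ : Finset (Finset V)).filter fun I => n / b ≤ I.card ∧ I.card ≤ hi
  have hsub : boundedRetractions V hi b ⊆
      𝓘.biUnion fun I => Fintype.piFinset fun x => if x ∈ I then {x} else I := by
    intro r hr
    obtain ⟨hidem, hcard, hfib⟩ := (Finset.mem_filter.1 hr).2
    have hn : n ≤ (Finset.univ.image r).card * b := by
      have := Finset.card_le_mul_card_image (f := r) (Finset.univ : Finset V) b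
        (fun a _ => (hfib a).le)
      rwa [mul_comm]
    refine Finset.mem_biUnion.2 ⟨Finset.univ.image r, ?_, ?_⟩
    · refine Finset.mem_filter.2 ⟨Finset.mem_univ _, ?_, hcard⟩
      exact Nat.div_le_of_le_mul (by rwa [mul_comm])
    · rw [Fintype.mem_piFinset]
      intro x
      split_ifs with hx
      · obtain ⟨y, -, rfl⟩ := Finset.mem_image.1 hx
        simp [hidem]
      · exact Finset.mem_image_of_mem r (Finset.mem_univ x)
  refine (Finset.card_le_card hsub).trans ((Finset.card_biUnion_le_card_mul _ _
    (hi ^ (n - n / b)) fun I hI => ?_).trans (Nat.mul_le_mul_right _ ?_))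
  · obtain ⟨hlo, hIhi⟩ := (Finset.mem_filter.1 hI).2
    have h1 : ∀ x : V, (if x ∈ I then {x} else I).card = if x ∈ I then 1 else I.card := by
      intro x
      split_ifs <;> simp
    rw [Fintype.card_piFinset]
    simp_rw [h1]
    rw [Finset.prod_ite, Finset.prod_const_one, one_mul, Finset.prod_const]
    have h2 := Finset.card_filter_add_card_filter_not (s := (Finset.univ : Finset V)) (· ∈ I)
    rw [Finset.filter_univ_mem, Finset.card_univ] at h2
    calc I.card ^ (Finset.univ.filter fun x => x ∉ I).card
        ≤ hi ^ (Finset.univ.filter fun x => x ∉ I).card := Nat.pow_le_pow_left hIhi _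
      _ ≤ hi ^ (n - n / b) := Nat.pow_le_pow_right hhi (by omega)
  · refine (Finset.card_filter_le _ _).trans ?_
    simp [n]

lemma Finset.exists_fin_cover {α : Type*} [Nonempty α] (E : Finset α) {h : ℕ} (hE : E.card ≤ h) :
    ∃ e : Fin h → α, ∀ x ∈ E, ∃ i, e i = x := by
  obtain ⟨f⟩ : Nonempty (E ↪ Fin h) := Function.Embedding.nonempty_of_card_le (by simpa using hE)
  refine ⟨Function.extend f (fun x => x.1) fun _ => Classical.arbitrary α, fun x hx => ?_⟩
  exact ⟨f ⟨x, hx⟩, f.injective.extend_apply _ _ _⟩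

/-- The pairs of vertices which lie in a common piece or in one of the given pairs of pieces. -/
def allowedEdges {h : ℕ} (r : V → V) (e : Fin h → V × V) : Finset (Sym2 V) :=
  ((Finset.univ : Finset (V × V)).filter fun p =>
    r p.1 = r p.2 ∨ ∃ i, e i = (r p.1, r p.2)).image Sym2.mk.uncurry

lemma card_allowedEdges_le {h b : ℕ} (r : V → V) (e : Fin h → V × V)
    (hr : ∀ a, (Finset.univ.filter fun x => r x = a).card < b) :
    (allowedEdges r e).card ≤ Fintype.card V * b + h * (b * b) := by
  have hsub : ((Finset.univ : Finset (V × V)).filter fun p =>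
      r p.1 = r p.2 ∨ ∃ i, e i = (r p.1, r p.2)) ⊆
      (Finset.univ.biUnion fun x : V => {x} ×ˢ Finset.univ.filter fun y => r y = r x) ∪
      (Finset.univ.biUnion fun i : Fin h => (Finset.univ.filter fun x => r x = (e i).1) ×ˢ
        (Finset.univ.filter fun x => r x = (e i).2)) := by
    rintro ⟨x, y⟩ hp
    rcases (Finset.mem_filter.1 hp).2 with h1 | ⟨i, hi⟩
    · exact Finset.mem_union_left _ (Finset.mem_biUnion.2
        ⟨x, Finset.mem_univ x, by simpa using h1.symm⟩)
    · exact Finset.mem_union_right _ (Finset.mem_biUnion.2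
        ⟨i, Finset.mem_univ i, by simp [hi]⟩)
  refine Finset.card_image_le.trans ((Finset.card_le_card hsub).trans
    ((Finset.card_union_le _ _).trans (add_le_add ?_ ?_)))
  · refine (Finset.card_biUnion_le_card_mul _ _ b fun x _ => ?_).trans (by simp)
    rw [Finset.card_product, Finset.card_singleton, one_mul]
    exact (hr _).le
  · refine (Finset.card_biUnion_le_card_mul _ _ (b * b) fun i _ => ?_).trans (by simp)
    rw [Finset.card_product]
    exact Nat.mul_le_mul (hr _).le (hr _).le

/-- The number of graphs with `m` edges whose vertices can be divided into at most `hi` pieces of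
fewer than `b` vertices such that the edges between the pieces run between at most `h` pairs of
pieces. -/
theorem ncard_graphs_with_pieces_le [Nonempty V] {hi h b m : ℕ} (hhi : 0 < hi)
    (𝒢 : Set (SimpleGraph V)) (hm : ∀ G ∈ 𝒢, G.edgeSet.ncard = m)
    (hG : ∀ G ∈ 𝒢, ∃ (g : V → V) (E : Finset (V × V)),
      (∀ a, (Finset.univ.filter fun x => g x = a).card < b) ∧
      (Finset.univ.image g).card ≤ hi ∧ E.card ≤ h ∧
      ∀ x y, G.Adj x y → g x = g y ∨ (g x, g y) ∈ E ∨ (g y, g x) ∈ E) :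
    𝒢.ncard ≤ 2 ^ Fintype.card V * hi ^ (Fintype.card V - Fintype.card V / b) *
      (Fintype.card V * Fintype.card V) ^ h *
        (Fintype.card V * b + h * (b * b)).choose m := by
  classical
  let 𝓕 : Finset (Finset (Sym2 V)) :=
    (boundedRetractions V hi b ×ˢ (Finset.univ : Finset (Fin h → V × V))).biUnion fun q =>
      Finset.powersetCard m (allowedEdges q.1 q.2)
  have h𝓕 : 𝓕.card ≤ 2 ^ Fintype.card V * hi ^ (Fintype.card V - Fintype.card V / b) *
      (Fintype.card V * Fintype.card V) ^ h *
        (Fintype.card V * b + h * (b * b)).choose m := by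
    refine (Finset.card_biUnion_le_card_mul _ _
      ((Fintype.card V * b + h * (b * b)).choose m) fun q hq => ?_).trans
      (Nat.mul_le_mul_right _ ?_)
    · rw [Finset.card_powersetCard]
      have := (Finset.mem_filter.1 (Finset.mem_product.1 hq).1).2
      exact Nat.choose_le_choose m (card_allowedEdges_le q.1 q.2 this.2.2)
    · rw [Finset.card_product]
      refine Nat.mul_le_mul (card_boundedRetractions_le hhi) ?_
      simp
  refine le_trans ?_ h𝓕
  rw [← Set.ncard_coe_finset 𝓕]
  refine Set.ncard_le_ncard_of_injOn (fun G : SimpleGraph V => G.edgeSet.toFinset) ?_ ?_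
    (Finset.finite_toSet 𝓕)
  · intro G hGmem
    obtain ⟨g, E, hfib, himg, hE, hcov⟩ := hG G hGmem
    let ρ : V → V := Function.invFun g
    have hρ : ∀ x, g (ρ (g x)) = g x := fun x => Function.invFun_eq ⟨x, rfl⟩
    obtain ⟨e, he⟩ := (E.image fun p => (ρ p.1, ρ p.2)).exists_fin_cover
      (Finset.card_image_le.trans hE)
    rw [Finset.mem_coe, Finset.mem_biUnion]
    refine ⟨(fun x => ρ (g x), e), ?_, ?_⟩
    · refine Finset.mem_product.2 ⟨Finset.mem_filter.2 ⟨Finset.mem_univ _, ?_, ?_, ?_⟩,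
        Finset.mem_univ _⟩
      · intro x
        simp only [hρ]
      · refine le_trans ?_ himg
        have : Finset.univ.image (fun x => ρ (g x)) = (Finset.univ.image g).image ρ := by
          rw [Finset.image_image]; rfl
        rw [this]
        exact Finset.card_image_le
      · intro a
        refine (Finset.card_le_card fun x hx => ?_).trans_lt (hfib (g a))
        simp only [Finset.mem_filter, Finset.mem_univ, true_and] at hx ⊢
        rw [← hx, hρ]
    · refine Finset.mem_powersetCard.2 ⟨?_, ?_⟩
      · intro z
        induction z with | _ x y => ?_
        intro hz
        have hxy : G.Adj x y := by simpa using hz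
        have hE' : ∀ x y, (g x, g y) ∈ E → ∃ i, e i = (ρ (g x), ρ (g y)) := fun x y hxy =>
          he _ (Finset.mem_image_of_mem (fun p : V × V => (ρ p.1, ρ p.2)) hxy)
        rcases hcov x y hxy with h1 | h1 | h1
        · exact Finset.mem_image.2 ⟨(x, y), Finset.mem_filter.2
            ⟨Finset.mem_univ _, Or.inl (congrArg ρ h1)⟩, rfl⟩
        · exact Finset.mem_image.2 ⟨(x, y), Finset.mem_filter.2
            ⟨Finset.mem_univ _, Or.inr (hE' x y h1)⟩, rfl⟩
        · exact Finset.mem_image.2 ⟨(y, x), Finset.mem_filter.2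
            ⟨Finset.mem_univ _, Or.inr (hE' y x h1)⟩, Sym2.eq_swap⟩
      · rw [← Set.ncard_eq_toFinset_card', hm G hGmem]
  · intro G _ G' _ hGG'
    simp only [Set.toFinset_inj] at hGG'
    exact SimpleGraph.edgeSet_injective hGG'

end Counting

/-! ### The number of regular graphs -/

/-- There are regular graphs of every admissible order and degree: circulant graphs. -/
lemma exists_regular_graph {d r : ℕ} (hdr : d < r) (heven : Even (d * r)) :
    ∃ G : SimpleGraph (ZMod r), ∀ v, (G.neighborSet v).ncard = d := by
  classical
  have : NeZero r := ⟨by omega⟩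
  let T : Finset ℕ := (Finset.Icc 1 (d / 2) ∪ Finset.Icc (r - d / 2) (r - 1)) ∪
    if Odd d then {r / 2} else ∅
  have hpar : d % 2 = 1 → r % 2 = 0 := by
    intro hd
    rcases Nat.even_mul.1 heven with h | h
    · rw [Nat.even_iff] at h; omega
    · exact Nat.even_iff.1 h
  have hT : ∀ a, a ∈ T ↔ (1 ≤ a ∧ a ≤ d / 2) ∨ (r - d / 2 ≤ a ∧ a ≤ r - 1) ∨
      (d % 2 = 1 ∧ a = r / 2) := by
    intro a
    simp only [T, Finset.mem_union, Finset.mem_Icc, ← Nat.odd_iff, or_assoc]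
    split_ifs with h <;> simp [h]
  have hTcard : T.card = d := by
    have h1 : Disjoint (Finset.Icc 1 (d / 2)) (Finset.Icc (r - d / 2) (r - 1)) := by
      rw [Finset.disjoint_left]
      intro a ha hb
      rw [Finset.mem_Icc] at ha hb
      omega
    have h2 : Disjoint (Finset.Icc 1 (d / 2) ∪ Finset.Icc (r - d / 2) (r - 1))
        (if Odd d then {r / 2} else ∅) := by
      split_ifs with h
      · rw [Finset.disjoint_singleton_right, Finset.mem_union, Finset.mem_Icc, Finset.mem_Icc]
        have := hpar (Nat.odd_iff.1 h)
        have := Nat.odd_iff.1 h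
        omega
      · exact Finset.disjoint_empty_right _
    rw [Finset.card_union_of_disjoint h2, Finset.card_union_of_disjoint h1, Nat.card_Icc,
      Nat.card_Icc]
    split_ifs with h
    · have := Nat.odd_iff.1 h
      simp only [Finset.card_singleton]
      omega
    · rw [Nat.odd_iff] at h
      simp only [Finset.card_empty]
      omega
  let S : Finset (ZMod r) := Finset.univ.filter fun x => x.val ∈ T
  have hS : S.card = d := by
    rw [← hTcard, ← Finset.card_image_of_injective S (ZMod.val_injective r)]
    congr 1
    ext a
    simp only [S, Finset.mem_image, Finset.mem_filter, Finset.mem_univ, true_and]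
    constructor
    · rintro ⟨x, hx, rfl⟩
      exact hx
    · intro ha
      have har : a < r := by
        rcases (hT a).1 ha with h | h | h <;> omega
      refine ⟨(a : ZMod r), ?_, ZMod.val_cast_of_lt har⟩
      rwa [ZMod.val_cast_of_lt har]
  have h0 : (0 : ZMod r) ∉ S := by
    simp only [S, Finset.mem_filter, Finset.mem_univ, true_and, ZMod.val_zero, hT]
    omega
  have hneg : ∀ x ∈ S, -x ∈ S := by
    intro x hx
    have hx0 : x ≠ 0 := fun h => h0 (h ▸ hx)
    have : NeZero x := ⟨hx0⟩
    have hlt := ZMod.val_lt x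
    simp only [S, Finset.mem_filter, Finset.mem_univ, true_and] at hx ⊢
    rw [hT] at hx ⊢
    rw [ZMod.val_neg_of_ne_zero]
    rcases hx with h | h | h
    · omega
    · omega
    · have := hpar h.1
      omega
  refine ⟨{ Adj := fun x y => x - y ∈ S
            symm := ⟨fun x y h => by simpa using hneg _ h⟩
            loopless := ⟨fun x h => h0 (by simpa using h)⟩ }, fun v => ?_⟩
  have : {y | v - y ∈ S} = (fun s => v - s) '' (S : Set (ZMod r)) := by
    ext y
    simp only [Set.mem_ofPred_eq, Set.mem_image, Finset.mem_coe]
    constructor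
    · intro h
      exact ⟨v - y, h, by simp⟩
    · rintro ⟨s, hs, rfl⟩
      simpa using hs
  change {y | v - y ∈ S}.ncard = d
  rw [this, Set.ncard_image_of_injective _ (sub_right_injective), Set.ncard_coe_finset, hS]

/-- The pairs `i < j` of elements of `Fin k`, that is, the edges of the complete graph. -/
abbrev OrderedPairs (k : ℕ) : Type := {p : Fin k × Fin k // p.1 < p.2}

lemma card_orderedPairs (k : ℕ) : Fintype.card (OrderedPairs k) = k.choose 2 := by
  rw [Fintype.card_subtype, Finset.card_filter, Fintype.sum_prod_type_right]
  have h : ∀ j : Fin k, (∑ i : Fin k, if i < j then 1 else 0) = (j : ℕ) := by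
    intro j
    rw [← Finset.card_filter, Finset.filter_gt_eq_Iio, Fin.card_Iio]
  simp_rw [h]
  rw [Fin.sum_univ_eq_sum_range (fun i => i), Finset.sum_range_id, Nat.choose_two_right]

/-- The permutation attached to an ordered pair of vertices of the complete graph. -/
def pairPerm {k m : ℕ} (π : OrderedPairs k → Equiv.Perm (Fin m)) (i j : Fin k) :
    Equiv.Perm (Fin m) :=
  if h : i < j then π ⟨(i, j), h⟩ else if h : j < i then (π ⟨(j, i), h⟩).symm else 1

lemma pairPerm_symm {k m : ℕ} (π : OrderedPairs k → Equiv.Perm (Fin m)) (i j : Fin k) :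
    (pairPerm π i j).symm = pairPerm π j i := by
  unfold pairPerm
  rcases lt_trichotomy i j with h | rfl | h
  · simp [h, h.not_gt]
  · simp [Equiv.Perm.one_def]
  · simp [h, h.not_gt]

/-- The lift of the complete graph on `k` vertices in which the vertices over `i` are matched with
those over `j` by a given permutation. -/
def liftGraph {k m : ℕ} (π : OrderedPairs k → Equiv.Perm (Fin m)) :
    SimpleGraph (Fin k × Fin m) where
  Adj a b := a.1 ≠ b.1 ∧ pairPerm π a.1 b.1 a.2 = b.2
  symm := ⟨fun a b h => ⟨h.1.symm, by rw [← pairPerm_symm, ← h.2, Equiv.symm_apply_apply]⟩⟩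
  loopless := ⟨fun a h => h.1 rfl⟩

lemma ncard_neighborSet_liftGraph {d m : ℕ} (π : OrderedPairs (d + 1) → Equiv.Perm (Fin m))
    (a : Fin (d + 1) × Fin m) : ((liftGraph π).neighborSet a).ncard = d := by
  have h1 : (liftGraph π).neighborSet a =
      (fun j => (j, pairPerm π a.1 j a.2)) '' ({a.1}ᶜ : Set (Fin (d + 1))) := by
    ext ⟨j, y⟩
    simp only [SimpleGraph.mem_neighborSet, liftGraph, Set.mem_image, Set.mem_compl_iff,
      Set.mem_singleton_iff, Prod.mk.injEq]
    constructor
    · rintro ⟨h, rfl⟩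
      exact ⟨j, fun h' => h h'.symm, rfl, rfl⟩
    · rintro ⟨_, h, rfl, rfl⟩
      exact ⟨fun h' => h h'.symm, rfl⟩
  rw [h1, Set.ncard_image_of_injective _ fun i j h => congrArg Prod.fst h, Set.ncard_compl,
    Set.ncard_singleton]
  simp

lemma liftGraph_injective (k m : ℕ) :
    Function.Injective (liftGraph : (OrderedPairs k → Equiv.Perm (Fin m)) → _) := by
  intro π π' h
  funext ⟨⟨i, j⟩, hij⟩
  have hij' : i < j := hij
  ext x
  have h1 : (liftGraph π).Adj (i, x) (j, π ⟨(i, j), hij⟩ x) := ⟨hij'.ne, by simp [pairPerm, hij']⟩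
  rw [h] at h1
  have h2 := h1.2
  simp only [pairPerm, hij', dite_true] at h2
  rw [h2]

lemma ncard_neighborSet_sum {α β : Type*} [Finite α] [Finite β] (G : SimpleGraph α)
    (H : SimpleGraph β) {d : ℕ} (hG : ∀ v, (G.neighborSet v).ncard = d)
    (hH : ∀ v, (H.neighborSet v).ncard = d) (v : α ⊕ β) : ((G ⊕g H).neighborSet v).ncard = d := by
  rcases v with v | v
  · have : (G ⊕g H).neighborSet (Sum.inl v) = Sum.inl '' G.neighborSet v := by
      ext (x | x) <;> simp
    rw [this, Set.ncard_image_of_injective _ Sum.inl_injective, hG]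
  · have : (G ⊕g H).neighborSet (Sum.inr v) = Sum.inr '' H.neighborSet v := by
      ext (x | x) <;> simp
    rw [this, Set.ncard_image_of_injective _ Sum.inr_injective, hH]

lemma mem_regularGraphs_iff {d n : ℕ} (G : SimpleGraph (Fin n)) :
    G ∈ regularGraphs d n ↔ ∀ v, (G.neighborSet v).ncard = d := by
  classical
  rw [regularGraphs, Set.mem_ofPred_eq, SimpleGraph.isRegularOfDegree_iff_ncard]

/-- There are at least `m! ^ (d * (d + 1) / 2)` graphs of degree `d` on `n` vertices, where `m` is
about `n / (d + 1)`: disjoint unions of a lift of the complete graph on `d + 1` vertices and a fixed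
regular graph that takes care of the divisibility. -/
theorem factorial_pow_le_ncard_regularGraphs {d n m : ℕ} (hm : (d + 1) * m + d < n)
    (heven : Even (d * n)) :
    m.factorial ^ ((d + 1).choose 2) ≤ (regularGraphs d n).ncard := by
  classical
  let r := n - (d + 1) * m
  have hr : d < r := by omega
  have hn : n = (d + 1) * m + r := by omega
  have : NeZero r := ⟨by omega⟩
  obtain ⟨C, hC⟩ := exists_regular_graph hr (by
    rw [hn, mul_add, ← mul_assoc, Nat.even_add] at heven
    exact heven.1 ((Nat.even_mul_succ_self d).mul_right m))
  let e : (Fin (d + 1) × Fin m) ⊕ ZMod r ≃ Fin n := Fintype.equivFinOfCardEq (by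
    rw [Fintype.card_sum, Fintype.card_prod, Fintype.card_fin, Fintype.card_fin, ZMod.card, hn])
  let F : (OrderedPairs (d + 1) → Equiv.Perm (Fin m)) → SimpleGraph (Fin n) := fun π =>
    (liftGraph π ⊕g C).comap e.symm
  have hF : Function.Injective F := by
    intro π π' h
    apply liftGraph_injective
    ext a b
    have h1 : (F π).Adj (e (Sum.inl a)) (e (Sum.inl b)) ↔
        (F π').Adj (e (Sum.inl a)) (e (Sum.inl b)) := by rw [h]
    simpa [F] using h1
  have hmem : ∀ π, F π ∈ regularGraphs d n := by
    intro π
    rw [mem_regularGraphs_iff]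
    intro v
    have h1 : (F π).neighborSet v = e '' (liftGraph π ⊕g C).neighborSet (e.symm v) := by
      ext x
      rw [Equiv.image_eq_preimage_symm]
      rfl
    rw [h1, Set.ncard_image_of_injective _ e.injective]
    exact ncard_neighborSet_sum _ _ (ncard_neighborSet_liftGraph π) hC _
  calc m.factorial ^ ((d + 1).choose 2)
      = Fintype.card (OrderedPairs (d + 1) → Equiv.Perm (Fin m)) := by
        rw [Fintype.card_fun, Fintype.card_perm, Fintype.card_fin, card_orderedPairs]
    _ = (Set.range F).ncard := by
        rw [← Set.image_univ, Set.ncard_image_of_injective _ hF, Set.ncard_univ,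
          Nat.card_eq_fintype_card]
    _ ≤ _ := Set.ncard_le_ncard (Set.range_subset_iff.2 hmem) (Set.toFinite _)

/-! ### The lower bound -/

/-- The number of `d`-regular graphs on `n` vertices is at least `n ^ (d * n / 2) / exp (O(n))`. -/
lemma exp_le_ncard_regularGraphs {d : ℕ} (hd : 1 ≤ d) :
    ∃ c : ℝ, ∀ᶠ n : ℕ in atTop, Even (d * n) →
      Real.exp ((d : ℝ) / 2 * n * Real.log n - c * n) ≤ ((regularGraphs d n).ncard : ℝ) := by
  set k : ℝ := Real.log (6 * (d + 1)) with hk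
  refine ⟨(d : ℝ) / 2 * k + d * (d + 1), ?_⟩
  filter_upwards [eventually_ge_atTop (6 * (d + 1))] with n hn heven
  set m := n / (d + 1) - 1 with hm
  have hdR : (1 : ℝ) ≤ d := by exact_mod_cast hd
  have hdiv : 6 ≤ n / (d + 1) := (Nat.le_div_iff_mul_le (by omega)).2 hn
  have hnR : (6 : ℝ) * (d + 1) ≤ n := by exact_mod_cast hn
  have hn0 : (0 : ℝ) < n := by nlinarith
  have hm1 : (d + 1) * m + d < n := by
    have h1 := Nat.mul_div_le n (d + 1)
    have h2 : (d + 1) * m + (d + 1) = (d + 1) * (n / (d + 1)) := by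
      rw [hm, ← Nat.mul_succ]; congr 1; omega
    omega
  have hm2 : (n : ℝ) ≤ (d + 1) * (m + 2) := by
    have h1 := Nat.lt_mul_div_succ n (by omega : 0 < d + 1)
    have h2 : n / (d + 1) + 1 = m + 2 := by omega
    rw [h2] at h1
    exact_mod_cast h1.le
  have hm5 : (5 : ℝ) ≤ m := by
    have : 5 ≤ m := by omega
    exact_mod_cast this
  have hm3 : (n : ℝ) / (6 * (d + 1)) ≤ (m : ℝ) / 3 := by
    rw [div_le_div_iff₀ (by positivity) (by norm_num)]
    nlinarith
  have hone : 1 ≤ (n : ℝ) / (6 * (d + 1)) := by rwa [one_le_div (by positivity)]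
  set x : ℝ := (n : ℝ) / (6 * (d + 1)) with hx
  have hlogx : Real.log x = Real.log n - k := by
    rw [hx, Real.log_div hn0.ne' (by positivity)]
  have hlogx0 : 0 ≤ Real.log x := Real.log_nonneg hone
  have hfac : Real.exp (m * Real.log x) ≤ m.factorial := by
    rw [Real.exp_nat_mul, Real.exp_log (by linarith)]
    exact (pow_le_pow_left₀ (by linarith) hm3 m).trans (div_three_pow_le_factorial m)
  have hchoose : (((d + 1).choose 2 : ℕ) : ℝ) = (d : ℝ) * (d + 1) / 2 := by
    rw [Nat.cast_choose_two]; push_cast; ring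
  calc Real.exp ((d : ℝ) / 2 * n * Real.log n - ((d : ℝ) / 2 * k + d * (d + 1)) * n)
      ≤ Real.exp (((d + 1).choose 2 : ℕ) * (m * Real.log x)) := by
        apply Real.exp_le_exp.2
        rw [hchoose]
        have h1 : (d : ℝ) / 2 * n - d * (d + 1) ≤ (d : ℝ) * (d + 1) / 2 * m := by
          nlinarith
        have h2 : Real.log x ≤ n := by
          rw [hlogx]
          have h3 := Real.log_le_sub_one_of_pos hn0
          have h4 : 0 ≤ k := Real.log_nonneg (by nlinarith)
          linarith
        have h3 : ((d : ℝ) / 2 * n - d * (d + 1)) * Real.log x ≤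
            (d : ℝ) * (d + 1) / 2 * m * Real.log x := mul_le_mul_of_nonneg_right h1 hlogx0
        have h4 : d * (d + 1) * Real.log x ≤ d * (d + 1) * n :=
          mul_le_mul_of_nonneg_left h2 (by positivity)
        have h5 : Real.log n = Real.log x + k := by linarith
        rw [h5]
        linarith
    _ = Real.exp (m * Real.log x) ^ ((d + 1).choose 2) := (Real.exp_nat_mul _ _)
    _ ≤ (m.factorial : ℝ) ^ ((d + 1).choose 2) :=
        pow_le_pow_left₀ (Real.exp_pos _).le hfac _
    _ ≤ _ := by exact_mod_cast factorial_pow_le_ncard_regularGraphs hm1 heven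

/-- A family whose logarithmic size is by `δ * n * log n` smaller than that of the family of all
`d`-regular graphs contains only a vanishing proportion of the latter. -/
lemma eventually_ncard_le_mul_ncard_regularGraphs {d : ℕ} (hd : 1 ≤ d) {δ C : ℝ} (hδ : 0 < δ)
    (𝒢 : ∀ n, Set (SimpleGraph (Fin n)))
    (h𝒢 : ∀ᶠ n : ℕ in atTop, Even (d * n) →
      ((𝒢 n).ncard : ℝ) ≤ Real.exp (((d : ℝ) / 2 - δ) * n * Real.log n + C * n))
    {η : ℝ} (hη : 0 < η) :
    ∀ᶠ n : ℕ in atTop, Even (d * n) →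
      ((𝒢 n).ncard : ℝ) ≤ η * (regularGraphs d n).ncard := by
  obtain ⟨c, hc⟩ := exp_le_ncard_regularGraphs hd
  have hlog : Tendsto (fun n : ℕ => Real.log n) atTop atTop :=
    Real.tendsto_log_atTop.comp tendsto_natCast_atTop_atTop
  have hnat : Tendsto (fun n : ℕ => (n : ℝ)) atTop atTop := tendsto_natCast_atTop_atTop
  filter_upwards [h𝒢, hc, hlog.eventually_ge_atTop ((C + c + 1) / δ),
    hnat.eventually_ge_atTop (-Real.log η)] with n h1 h2 h3 h4 heven
  refine (h1 heven).trans (le_trans ?_ (mul_le_mul_of_nonneg_left (h2 heven) hη.le))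
  conv_rhs => rw [← Real.exp_log hη]
  rw [← Real.exp_add]
  apply Real.exp_le_exp.2
  rw [div_le_iff₀ hδ] at h3
  have h5 : (C + c + 1) * n ≤ Real.log n * δ * n :=
    mul_le_mul_of_nonneg_right h3 (Nat.cast_nonneg n)
  linarith

lemma edgeSet_ncard_of_mem_regularGraphs {d n : ℕ} {G : SimpleGraph (Fin n)}
    (hG : G ∈ regularGraphs d n) : G.edgeSet.ncard = d * n / 2 := by
  classical
  -- Passing through `ncard` exchanges the classical instance in `regularGraphs` for the present one.
  rw [regularGraphs, Set.mem_ofPred_eq, SimpleGraph.isRegularOfDegree_iff_ncard,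
    ← SimpleGraph.isRegularOfDegree_iff_ncard] at hG
  have h1 := G.sum_degrees_eq_twice_card_edges
  simp_rw [hG.degree_eq] at h1
  rw [Finset.sum_const, Finset.card_univ, Fintype.card_fin, smul_eq_mul] at h1
  rw [← SimpleGraph.coe_edgeFinset, Set.ncard_coe_finset]
  rw [mul_comm d n, h1]
  omega

lemma card_lt_of_mem_regularGraphs {d n s : ℕ} {G : SimpleGraph (Fin n)}
    (hG : G ∈ regularGraphs d n) (hs : d < s) (y : Fin n) (T : Finset (Fin n))
    (hT : ∀ x ∈ T, G.Adj x y) : T.card < s := by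
  rw [mem_regularGraphs_iff] at hG
  rw [← Set.ncard_coe_finset]
  refine lt_of_le_of_lt ?_ hs
  rw [← hG y]
  exact Set.ncard_le_ncard (fun x hx => (hT x hx).symm) (Set.toFinite _)

lemma ncard_regularGraphs_twinWidth_le {d n w s : ℕ} (hd : 2 ≤ d) (hn : 0 < n) (hs : d < s) :
    {G ∈ regularGraphs d n | twinWidth G ≤ w}.ncard ≤
      2 ^ n * (n / s + 1) ^ (n - n / (2 * s)) * (n * n) ^ (w * n / s) *
        (n * (2 * s) + w * n / s * (2 * s * (2 * s))).choose (d * n / 2) := by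
  have : Nonempty (Fin n) := ⟨⟨0, hn⟩⟩
  have h := ncard_graphs_with_pieces_le (V := Fin n) (hi := n / s + 1) (h := w * n / s)
    (b := 2 * s) (m := d * n / 2) (Nat.succ_pos _)
    {G ∈ regularGraphs d n | twinWidth G ≤ w}
    (fun G hG => edgeSet_ncard_of_mem_regularGraphs hG.1) ?_
  · simpa only [Fintype.card_fin] using h
  · rintro G ⟨hG, hw⟩
    obtain ⟨g, E, h1, h2, h3, h4⟩ :=
      ((hasContractionSequence_twinWidth G).mono hw).exists_pieces (s := s) (by omega)
        (card_lt_of_mem_regularGraphs hG hs)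
    rw [Fintype.card_fin] at h2 h3
    refine ⟨g, E, h1, ?_, ?_, h4⟩
    · rw [← Nat.add_div_right n (by omega)]
      exact (Nat.le_div_iff_mul_le (by omega)).2 h2
    · exact (Nat.le_div_iff_mul_le (by omega)).2 h3

lemma two_le_exp_one : (2 : ℝ) ≤ Real.exp 1 := by
  have := Real.exp_one_gt_d9
  linarith

/-- With pieces of between `3` and `5` vertices and no edges between them, the partition is
determined by the values of a retraction at `5 / 6` of the points. -/
lemma ncard_two_regular_twinWidth_zero_le {n : ℕ} (hn : 0 < n) :
    ({G ∈ regularGraphs 2 n | twinWidth G ≤ 0}.ncard : ℝ) ≤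
      Real.exp ((((2 : ℕ) : ℝ) / 2 - 1 / 6) * n * Real.log n + 9 * n) := by
  have h1 := ncard_regularGraphs_twinWidth_le (d := 2) (w := 0) (s := 3) le_rfl hn (by norm_num)
  have hn0 : (0 : ℝ) < n := by exact_mod_cast hn
  have hn1 : (1 : ℝ) ≤ n := by exact_mod_cast hn
  have h2 : {G ∈ regularGraphs 2 n | twinWidth G ≤ 0}.ncard ≤
      2 ^ n * n ^ (n - n / 6) * 2 ^ (n * 6) := by
    refine h1.trans ?_
    simp only [zero_mul, Nat.zero_div, pow_zero, mul_one, add_zero]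
    refine Nat.mul_le_mul (Nat.mul_le_mul_left _ ?_) (Nat.choose_le_two_pow _ _)
    exact Nat.pow_le_pow_left (by omega) _
  have hL0 : 0 ≤ Real.log n := Real.log_nonneg hn1
  have hL : Real.log n ≤ n := by
    have := Real.log_le_sub_one_of_pos hn0
    linarith
  have h3 : ((n - n / 6 : ℕ) : ℝ) ≤ 5 / 6 * n + 1 := by
    have h4 : 6 * (n - n / 6) ≤ 5 * n + 6 := by omega
    have h5 : (6 : ℝ) * ((n - n / 6 : ℕ) : ℝ) ≤ 5 * n + 6 := by exact_mod_cast h4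
    linarith
  calc ({G ∈ regularGraphs 2 n | twinWidth G ≤ 0}.ncard : ℝ)
      ≤ 2 ^ n * (n : ℝ) ^ (n - n / 6) * 2 ^ (n * 6) := by exact_mod_cast h2
    _ ≤ Real.exp 1 ^ n * Real.exp (Real.log n) ^ (n - n / 6) * Real.exp 1 ^ (n * 6) := by
        have := two_le_exp_one
        rw [Real.exp_log hn0]
        gcongr
    _ = Real.exp (n + ((n - n / 6 : ℕ) : ℝ) * Real.log n + n * 6) := by
        rw [← Real.exp_nat_mul, ← Real.exp_nat_mul, ← Real.exp_nat_mul, ← Real.exp_add,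
          ← Real.exp_add]
        push_cast
        ring_nf
    _ ≤ _ := by
        apply Real.exp_le_exp.2
        have h6 := mul_le_mul_of_nonneg_right h3 hL0
        push_cast
        linarith

lemma choose_le_three_mul_div_pow {M m : ℕ} (hm : 0 < m) :
    ((M.choose m : ℕ) : ℝ) ≤ (3 * M / m) ^ m := by
  have h1 : (M.choose m : ℝ) ≤ (M : ℝ) ^ m / m.factorial := Nat.choose_le_pow_div m M
  have h2 := div_three_pow_le_factorial m
  have hm' : (0 : ℝ) < m := by exact_mod_cast hm
  calc (M.choose m : ℝ) ≤ (M : ℝ) ^ m / m.factorial := h1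
    _ ≤ (M : ℝ) ^ m / ((m : ℝ) / 3) ^ m := by gcongr
    _ = (3 * M / m) ^ m := by rw [← div_pow]; congr 1; field_simp

/-- The counting bound for the width `w ≈ n ^ (γ - δ)` and pieces of size `s ≈ n ^ (γ - δ / 2)`. -/
lemma eventually_ncard_twinWidth_lt_le {d : ℕ} (hd : 3 ≤ d) {δ : ℝ} (hδ : 0 < δ)
    (hδγ : δ ≤ ((d : ℝ) - 2) / (2 * d - 2)) :
    ∀ᶠ n : ℕ in atTop, Even (d * n) →
      ({G ∈ regularGraphs d n |
        (twinWidth G : ℝ) < (n : ℝ) ^ (((d : ℝ) - 2) / (2 * d - 2) - δ)}.ncard : ℝ) ≤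
      Real.exp (((d : ℝ) / 2 - δ) * n * Real.log n + (2 + 4 / δ + 2 * d) * n) := by
  set γ : ℝ := ((d : ℝ) - 2) / (2 * d - 2) with hγ
  have hdR : (3 : ℝ) ≤ d := by exact_mod_cast hd
  have hγd : ((d : ℝ) - 1) * γ = (d - 2) / 2 := by
    have h1 : ((d : ℝ) - 1) ≠ 0 := by linarith
    rw [hγ, show 2 * (d : ℝ) - 2 = (d - 1) * 2 by ring, ← mul_div_assoc, mul_div_mul_left _ _ h1]
  have hγ1 : γ ≤ 1 := (div_le_one (by linarith)).2 (by linarith)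
  have htend : Tendsto (fun n : ℕ => (n : ℝ) ^ (γ - δ / 2)) atTop atTop :=
    (tendsto_rpow_atTop (by linarith)).comp tendsto_natCast_atTop_atTop
  filter_upwards [htend.eventually_gt_atTop (d : ℝ), eventually_ge_atTop 1] with n hnd hn heven
  have hn1 : (1 : ℝ) ≤ n := by exact_mod_cast hn
  have hn0 : (0 : ℝ) < n := by linarith
  set L := Real.log n with hL
  have hL0 : 0 ≤ L := Real.log_nonneg hn1
  have hpow : ∀ a : ℝ, (n : ℝ) ^ a = Real.exp (a * L) := fun a => by
    rw [Real.rpow_def_of_pos hn0, mul_comm]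
  have hnexp : (n : ℝ) = Real.exp L := (Real.exp_log hn0).symm
  -- The pieces are larger than the twin-width by the small factor `n ^ (δ / 2)`.
  set A : ℝ := Real.exp ((γ - δ / 2) * L) with hA
  set B : ℝ := Real.exp ((γ - δ) * L) with hB
  have hB1 : 1 ≤ B := Real.one_le_exp (mul_nonneg (by linarith) hL0)
  have hA1 : 1 ≤ A := Real.one_le_exp (mul_nonneg (by linarith) hL0)
  rw [hpow] at hnd
  rw [hpow]
  set w := ⌊B⌋₊
  set s := ⌈A⌉₊
  have hw1 : 1 ≤ w := Nat.floor_pos.2 hB1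
  have hwB : (w : ℝ) ≤ B := Nat.floor_le (by linarith)
  have hAs : A ≤ s := Nat.le_ceil A
  have hs2 : (s : ℝ) ≤ 2 * A := by
    have := (Nat.ceil_lt_add_one (by linarith : 0 ≤ A)).le
    linarith
  have hds : d < s := by exact_mod_cast hnd.trans_le hAs
  have hs0 : (0 : ℝ) < s := by linarith
  set h := w * n / s
  set m := d * n / 2
  have hm2 : 2 * m = d * n := Nat.two_mul_div_two_of_even heven
  have hmR : (m : ℝ) = d * n / 2 := by
    have : (2 : ℝ) * m = d * n := by exact_mod_cast hm2
    linarith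
  have hm0 : 0 < m := by
    have : 0 < d * n := by positivity
    omega
  have hcount : {G ∈ regularGraphs d n | (twinWidth G : ℝ) < B}.ncard ≤
      2 ^ n * (n / s + 1) ^ (n - n / (2 * s)) * (n * n) ^ h *
        (n * (2 * s) + h * (2 * s * (2 * s))).choose m := by
    refine le_trans (Set.ncard_le_ncard ?_ (Set.toFinite _))
      (ncard_regularGraphs_twinWidth_le (w := w) (by omega) hn hds)
    rintro G ⟨hG, hlt⟩
    exact ⟨hG, Nat.le_floor hlt.le⟩
  have hfac1 : (2 : ℝ) ^ n ≤ Real.exp n := by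
    rw [← mul_one (n : ℝ), Real.exp_nat_mul]
    exact pow_le_pow_left₀ (by norm_num) two_le_exp_one n
  have hfac2 : (((n / s + 1 : ℕ) : ℝ)) ^ (n - n / (2 * s)) ≤
      Real.exp (n * (1 + (1 - γ + δ / 2) * L)) := by
    have h1 : ((n / s + 1 : ℕ) : ℝ) ≤ Real.exp (1 + (1 - γ + δ / 2) * L) := by
      have h2 : ((n / s : ℕ) : ℝ) ≤ Real.exp ((1 - γ + δ / 2) * L) := by
        calc ((n / s : ℕ) : ℝ) ≤ n / s := Nat.cast_div_le
          _ ≤ n / A := by gcongr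
          _ = Real.exp ((1 - γ + δ / 2) * L) := by
              conv_lhs => rw [hnexp]
              rw [hA, ← Real.exp_sub]
              congr 1; ring
      have h3 : 1 ≤ Real.exp ((1 - γ + δ / 2) * L) :=
        Real.one_le_exp (mul_nonneg (by linarith) hL0)
      have h4 := mul_le_mul_of_nonneg_right two_le_exp_one (by linarith :
        0 ≤ Real.exp ((1 - γ + δ / 2) * L))
      rw [Real.exp_add]
      push_cast
      linarith
    have h5 : (1 : ℝ) ≤ ((n / s + 1 : ℕ) : ℝ) := by
      exact_mod_cast Nat.succ_le_succ (Nat.zero_le _)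
    calc (((n / s + 1 : ℕ) : ℝ)) ^ (n - n / (2 * s)) ≤ (((n / s + 1 : ℕ) : ℝ)) ^ n :=
          pow_le_pow_right₀ h5 (Nat.sub_le _ _)
      _ ≤ Real.exp (1 + (1 - γ + δ / 2) * L) ^ n := pow_le_pow_left₀ (by linarith) h1 n
      _ = _ := (Real.exp_nat_mul _ _).symm
  have hfac3 : ((n : ℝ) * n) ^ h ≤ Real.exp (4 / δ * n) := by
    have h1 : (h : ℝ) ≤ n * Real.exp (-(δ / 2 * L)) := by
      calc (h : ℝ) ≤ ((w * n : ℕ) : ℝ) / s := Nat.cast_div_le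
        _ ≤ B * n / A := by push_cast; gcongr
        _ = n * (B / A) := by ring
        _ = _ := by
            rw [hA, hB, ← Real.exp_sub]
            congr 2; ring
    have h2 : L ≤ Real.exp (δ / 2 * L) / (δ / 2) := by
      rw [← hpow]
      exact Real.log_le_rpow_div hn0.le (half_pos hδ)
    have h3 : (h : ℝ) * (2 * L) ≤ 4 / δ * n := by
      calc (h : ℝ) * (2 * L)
          ≤ n * Real.exp (-(δ / 2 * L)) * (2 * (Real.exp (δ / 2 * L) / (δ / 2))) := by gcongr
        _ = n * (2 / (δ / 2)) * (Real.exp (-(δ / 2 * L)) * Real.exp (δ / 2 * L)) := by ring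
        _ = 4 / δ * n := by
            rw [← Real.exp_add, neg_add_cancel, Real.exp_zero]
            field_simp; norm_num
    calc ((n : ℝ) * n) ^ h = Real.exp (h * (2 * L)) := by
          rw [Real.exp_nat_mul]
          congr 1
          conv_lhs => rw [hnexp]
          rw [← Real.exp_add]; ring_nf
      _ ≤ _ := Real.exp_le_exp.2 h3
  have hfac4 : (((n * (2 * s) + h * (2 * s * (2 * s))).choose m : ℕ) : ℝ) ≤
      Real.exp (m * (4 + (2 * γ - 3 * δ / 2) * L)) := by
    have h1 : n * (2 * s) + h * (2 * s * (2 * s)) ≤ 6 * (n * (w * s)) := by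
      have h2 : h * s ≤ w * n := Nat.div_mul_le_self _ _
      calc n * (2 * s) + h * (2 * s * (2 * s)) = 2 * (n * (1 * s)) + 4 * s * (h * s) := by ring
        _ ≤ 2 * (n * (w * s)) + 4 * s * (w * n) := by gcongr
        _ = 6 * (n * (w * s)) := by ring
    have h3 : ((n * (2 * s) + h * (2 * s * (2 * s)) : ℕ) : ℝ) ≤ 12 * (n * (B * A)) := by
      calc ((n * (2 * s) + h * (2 * s * (2 * s)) : ℕ) : ℝ) ≤ ((6 * (n * (w * s)) : ℕ) : ℝ) := by
            exact_mod_cast h1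
        _ = 6 * (n * (w * s)) := by push_cast; ring
        _ ≤ 6 * (n * (B * (2 * A))) := by gcongr
        _ = _ := by ring
    have hmn : (n : ℝ) ≤ m := by rw [hmR]; nlinarith
    have hmpos : (0 : ℝ) < m := by linarith
    rw [Real.exp_nat_mul]
    refine (choose_le_three_mul_div_pow hm0).trans (pow_le_pow_left₀ (by positivity) ?_ m)
    have h36 : (36 : ℝ) ≤ Real.exp 4 := by
      have h5 : (2.7 : ℝ) ≤ Real.exp 1 := by
        have := Real.exp_one_gt_d9
        linarith
      have h6 : Real.exp 4 = Real.exp 1 ^ 4 := by rw [← Real.exp_nat_mul]; norm_num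
      rw [h6]
      refine le_trans ?_ (pow_le_pow_left₀ (by norm_num) h5 4)
      norm_num
    rw [div_le_iff₀ hmpos]
    calc 3 * ((n * (2 * s) + h * (2 * s * (2 * s)) : ℕ) : ℝ) ≤ 3 * (12 * (n * (B * A))) := by
          gcongr
      _ = 36 * (B * A) * n := by ring
      _ ≤ Real.exp 4 * (B * A) * m := by gcongr
      _ = _ := by
          rw [hA, hB, ← Real.exp_add, ← Real.exp_add]
          congr 2; ring
  have hexp : n + n * (1 + (1 - γ + δ / 2) * L) + 4 / δ * n +
      m * (4 + (2 * γ - 3 * δ / 2) * L) ≤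
      ((d : ℝ) / 2 - δ) * n * L + (2 + 4 / δ + 2 * d) * n := by
    have h1 : 1 - γ + δ / 2 + (d : ℝ) / 2 * (2 * γ - 3 * δ / 2) ≤ (d : ℝ) / 2 - δ := by
      nlinarith
    have h2 := mul_le_mul_of_nonneg_right h1 (mul_nonneg hn0.le hL0)
    rw [hmR]
    linarith
  calc ({G ∈ regularGraphs d n | (twinWidth G : ℝ) < B}.ncard : ℝ)
      ≤ 2 ^ n * (((n / s + 1 : ℕ) : ℝ)) ^ (n - n / (2 * s)) * ((n : ℝ) * n) ^ h *
        (((n * (2 * s) + h * (2 * s * (2 * s))).choose m : ℕ) : ℝ) := by exact_mod_cast hcount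
    _ ≤ Real.exp n * Real.exp (n * (1 + (1 - γ + δ / 2) * L)) * Real.exp (4 / δ * n) *
        Real.exp (m * (4 + (2 * γ - 3 * δ / 2) * L)) := by gcongr
    _ ≤ _ := by
        rw [← Real.exp_add, ← Real.exp_add, ← Real.exp_add]
        exact Real.exp_le_exp.2 hexp

/-- For each `δ > 0` only a vanishing proportion of the `d`-regular graphs has twin-width less
than `n ^ (γ - δ)`, where `γ = (d - 2) / (2 * d - 2)`. -/
theorem eventually_ncard_twinWidth_lt_le_mul {d : ℕ} (hd : 2 ≤ d) {δ η : ℝ} (hδ : 0 < δ)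
    (hη : 0 < η) :
    ∀ᶠ n : ℕ in atTop, Even (d * n) →
      ({G ∈ regularGraphs d n |
        (twinWidth G : ℝ) < (n : ℝ) ^ (((d : ℝ) - 2) / (2 * d - 2) - δ)}.ncard : ℝ) ≤
      η * (regularGraphs d n).ncard := by
  set γ : ℝ := ((d : ℝ) - 2) / (2 * d - 2) with hγ
  rcases hd.eq_or_lt with rfl | hd
  · -- Here `γ = 0`, and the twin-width is zero.
    refine eventually_ncard_le_mul_ncard_regularGraphs (by norm_num)
      (by norm_num : (0 : ℝ) < 1 / 6) _ (C := 9) ?_ hη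
    filter_upwards [eventually_ge_atTop 1] with n hn _
    refine le_trans ?_ (ncard_two_regular_twinWidth_zero_le hn)
    have hn1 : (1 : ℝ) ≤ n := by exact_mod_cast hn
    refine Nat.cast_le.2 (Set.ncard_le_ncard ?_ (Set.toFinite _))
    rintro G ⟨hG, hlt⟩
    refine ⟨hG, ?_⟩
    have h1 : (n : ℝ) ^ (γ - δ) ≤ 1 :=
      Real.rpow_le_one_of_one_le_of_nonpos hn1 (by rw [hγ]; norm_num; exact hδ.le)
    have h2 : (twinWidth G : ℝ) < ((1 : ℕ) : ℝ) := by
      rw [Nat.cast_one]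
      exact hlt.trans_le h1
    have h3 : twinWidth G < 1 := Nat.cast_lt.1 h2
    omega
  · have hdR : (3 : ℝ) ≤ d := by exact_mod_cast hd
    have hγ0 : 0 < γ := div_pos (by linarith) (by linarith)
    have h1 := eventually_ncard_le_mul_ncard_regularGraphs (by omega) (lt_min hδ hγ0) _
      (eventually_ncard_twinWidth_lt_le hd (lt_min hδ hγ0) (min_le_right δ γ)) hη
    filter_upwards [h1, eventually_ge_atTop 1] with n hn hn1 heven
    refine le_trans (Nat.cast_le.2 (Set.ncard_le_ncard ?_ (Set.toFinite _))) (hn heven)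
    rintro G ⟨hG, hlt⟩
    refine ⟨hG, hlt.trans_le (Real.rpow_le_rpow_of_exponent_le (by exact_mod_cast hn1) ?_)⟩
    have := min_le_left δ γ
    linarith

/-! ### Almost all regular graphs -/

/-- Almost all `d`-regular graphs on `n` vertices have twin-width `n ^ (γ + o(1))`. -/
theorem exists_almostAllRegular_twinWidth {d : ℕ} (hd : 2 ≤ d) :
    ∃ ε : ℕ → ℝ, Tendsto ε atTop (𝓝 0) ∧
      AlmostAllRegular d fun n G =>
        (n : ℝ) ^ (((d : ℝ) - 2) / (2 * d - 2) - ε n) ≤ twinWidth G ∧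
          (twinWidth G : ℝ) ≤ (n : ℝ) ^ (((d : ℝ) - 2) / (2 * d - 2) + ε n) := by
  classical
  set γ : ℝ := ((d : ℝ) - 2) / (2 * d - 2) with hγ
  obtain ⟨ε₁, hε₁, hup⟩ := exists_forall_twinWidth_le_rpow hd
  have hlow := exists_tendsto_zero_of_eventually
    (fun δ n => 1 ≤ n → Even (d * n) →
      ({G ∈ regularGraphs d n | (twinWidth G : ℝ) < (n : ℝ) ^ (γ - δ)}.ncard : ℝ) ≤
        δ * (regularGraphs d n).ncard)
    (by
      intro n δ δ' hδ0 hδ h hn heven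
      refine le_trans (Nat.cast_le.2 (Set.ncard_le_ncard ?_ (Set.toFinite _)))
        ((h hn heven).trans (by gcongr))
      rintro G ⟨hG, hlt⟩
      exact ⟨hG, hlt.trans_le
        (Real.rpow_le_rpow_of_exponent_le (by exact_mod_cast hn) (by linarith))⟩)
    (by
      intro n
      refine ⟨1, zero_le_one, fun _ _ => ?_⟩
      rw [one_mul]
      exact Nat.cast_le.2 (Set.ncard_le_ncard (Set.sep_subset _ _) (Set.toFinite _)))
    (by
      intro δ hδ
      filter_upwards [eventually_ncard_twinWidth_lt_le_mul hd hδ hδ] with n hn _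
      exact hn)
  obtain ⟨ε₂, hε₂, hlow⟩ := hlow
  refine ⟨fun n => max (ε₁ n) (ε₂ n), by simpa using hε₁.max hε₂, ?_⟩
  obtain ⟨c, hc⟩ := exp_le_ncard_regularGraphs (by omega : 1 ≤ d)
  have hlim : Tendsto (fun n => 1 - ε₂ n) (atTop ⊓ 𝓟 {n : ℕ | Even (d * n)}) (𝓝 1) := by
    have h1 : Tendsto (fun n => 1 - ε₂ n) atTop (𝓝 (1 - 0)) := tendsto_const_nhds.sub hε₂
    rw [sub_zero] at h1
    exact h1.mono_left inf_le_left
  refine tendsto_of_tendsto_of_tendsto_of_le_of_le' hlim tendsto_const_nhds ?_ ?_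
  · rw [eventually_inf_principal]
    filter_upwards [hc, eventually_ge_atTop 1] with n hn hn1 heven
    have hn1' : (1 : ℝ) ≤ n := by exact_mod_cast hn1
    have hpos : (0 : ℝ) < (regularGraphs d n).ncard := (Real.exp_pos _).trans_le (hn heven)
    rw [le_div_iff₀ hpos]
    have hbad := (hlow n).2 hn1 heven
    have hcover : regularGraphs d n ⊆
        {G ∈ regularGraphs d n | (n : ℝ) ^ (γ - max (ε₁ n) (ε₂ n)) ≤ twinWidth G ∧
          (twinWidth G : ℝ) ≤ (n : ℝ) ^ (γ + max (ε₁ n) (ε₂ n))} ∪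
        {G ∈ regularGraphs d n | (twinWidth G : ℝ) < (n : ℝ) ^ (γ - ε₂ n)} := by
      intro G hG
      by_cases hlt : (twinWidth G : ℝ) < (n : ℝ) ^ (γ - ε₂ n)
      · exact Or.inr ⟨hG, hlt⟩
      · refine Or.inl ⟨hG, le_trans ?_ (not_lt.1 hlt), ?_⟩
        · refine Real.rpow_le_rpow_of_exponent_le hn1' ?_
          have := le_max_right (ε₁ n) (ε₂ n)
          linarith
        · have h1 := hup (Fin n) G ((SimpleGraph.isRegularOfDegree_iff_ncard G d).2
            ((mem_regularGraphs_iff G).1 hG))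
          rw [Fintype.card_fin] at h1
          refine h1.trans (Real.rpow_le_rpow_of_exponent_le hn1' ?_)
          have := le_max_left (ε₁ n) (ε₂ n)
          linarith
    have h2 := (Set.ncard_le_ncard hcover (Set.toFinite _)).trans (Set.ncard_union_le _ _)
    have h3 : ((regularGraphs d n).ncard : ℝ) ≤ _ := Nat.cast_le.2 h2
    rw [Nat.cast_add] at h3
    linarith
  · refine Eventually.of_forall fun n => div_le_one_of_le₀ ?_ (Nat.cast_nonneg _)
    exact Nat.cast_le.2 (Set.ncard_le_ncard (Set.sep_subset _ _) (Set.toFinite _))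

theorem theorem1p1 (d : ℕ) (hd : 2 ≤ d) :
    (∃ ε : ℕ → ℝ, Tendsto ε atTop (𝓝 0) ∧
      ∀ (V : Type*) [Fintype V] [DecidableEq V] (G : SimpleGraph V) [G.LocallyFinite],
        G.IsRegularOfDegree d →
          (twinWidth G : ℝ) ≤
            (Fintype.card V : ℝ) ^ (((d : ℝ) - 2) / (2 * d - 2) + ε (Fintype.card V))) ∧
    (∃ ε : ℕ → ℝ, Tendsto ε atTop (𝓝 0) ∧
      AlmostAllRegular d fun n G =>
        (n : ℝ) ^ (((d : ℝ) - 2) / (2 * d - 2) - ε n) ≤ twinWidth G ∧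
          (twinWidth G : ℝ) ≤ (n : ℝ) ^ (((d : ℝ) - 2) / (2 * d - 2) + ε n)) :=
  ⟨exists_forall_twinWidth_le_rpow hd, exists_almostAllRegular_twinWidth hd⟩
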